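/- **Setting.** There are $K\ge 2$ designs and $D\ge 1$ input components. The components $F_1,\dots,F_D$ are known probability distributions with densities $f_1,\dots,f_D$ with respect to a common $\sigma$-finite measure. For a weight vector $w$ in the simplex $\Delta=\{w\in\mathbb R^D: w_j\ge 0,\ \sum_j w_j=1\}$ put $F^w=\sum_j w_jF_j$. Assume: 1. The true input distribution is $F^{w^c}$, with $w^c_j>0$ for all $j$ and $\sum_j w^c_j=1$. 2. The simulation outputs $X_{i,j}^{(r)}$ ($1\le i\le K$, $1\le j\le D$, $r\ge 1$) are mutually independent, and $X_{i,j}^{(r)}\sim\mathcal N(\mu_{i,j},\sigma_{i,j}^2)$ with $\sigma_{i,j}>0$. 3. The input data $\xi_1,\xi_2,\dots$ are i.i.d. with law $F^{w^c}$. 4. (Identifiability) The Hellinger distance of $F^w$ and $F^{w^c}$ is nonzero for every $w\in\Delta$, $w\ne w^c$. 5. The stage-wise batch sizes $m(t)$ and budgets $n(t)$ ($t\ge1$, nonnegative integers) satisfy $\sum_t m(t)=\sum_t n(t)=\infty$. Let $\mu_i=\sum_j w^c_j\mu_{i,j}$. Assume that $\mu_1,\dots,\mu_K$ are pairwise distinct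 and let $b$ be the design with the largest $\mu_i$. Write $M(t)=\sum_{\tau\le t}m(\tau)$ and $N(t)=\sum_{\tau\le t}n(\tau)$. **Procedure IU-OCBA-balance.** Every pair $(i,j)$ is first simulated $n_0\ge 2$ times. In stage $t=1,2,\dots$ a maximum likelihood estimate $\hat w^{(t)}\in\Delta$ is computed from $\xi_1,\dots,\xi_{M(t)}$; then $n(t)$ times one pair is simulated, as follows. After $\ell$ simulations (the initial ones not counted) let $N_{i,j}^{(\ell)}$ be the number of outputs of the pair $(i,j)$ so far, initial ones included, let $\hat\mu_{i,j}^{(\ell)}$ and $\hat\sigma_{i,j}^{(\ell)}$ be their sample mean and sample standard deviation (with divisor $N_{i,j}^{(\ell)}-1$), and let $\hat\mu_i^{(\ell)}=\sum_j\hat w_j^{(t)}\hat\mu_{i,j}^{(\ell)}$, where $t$ is the current stage. Choose $\hat b^{(\ell)}\in\arg\max_i\hat\mu_i^{(\ell)}$. If $$\min_j\Big\{\Big(\tfrac{N_{\hat b^{(\ell)},j}^{(\ell)}}{\hat\sigma_{\hat b^{(\ell)},j}^{(\ell)}}\Big)^2-\sum_{i\ne\hat b^{(\ell)}}\Big(\tfrac{N_{i,j}^{(\ell)}}{\hat\sigma_{i,j}^{(\ell)}}\Big)^2\Big\}<0,$$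 put $I=\hat b^{(\ell)}$; otherwise choose $$I\in\arg\min_{i\ne\hat b^{(\ell)}}\frac{\big(\hat\mu^{(\ell)}_{\hat b^{(\ell)}}-\hat\mu_i^{(\ell)}\big)^2}{\sum_j(\hat\sigma^{(\ell)}_{\hat b^{(\ell)},j})^2(\hat w_j^{(t)})^2/N^{(\ell)}_{\hat b^{(\ell)},j}+\sum_j(\hat\sigma^{(\ell)}_{i,j})^2(\hat w_j^{(t)})^2/N^{(\ell)}_{i,j}}.$$ Choose $J\in\arg\min_j N_{I,j}^{(\ell)}/(\hat\sigma_{I,j}^{(\ell)}\hat w_j^{(t)})$ (the quotient being $+\infty$ if $\hat w^{(t)}_j=0$) and simulate the pair $(I,J)$ once. If stopped at the end of stage $t$, the procedure selects a design in $\arg\max_i\sum_j\hat w_j^{(t)}\hat\mu_{i,j}^{(N(t))}$. Ties are broken arbitrarily. **Theorem 3.** Let $\alpha_{i,j}^{(\ell)}=N_{i,j}^{(\ell)}/\sum_{i',j'}N_{i',j'}^{(\ell)}$. Then for IU-OCBA-balance: 1. (Consistency) Almost surely, the design selected at the end of stage $t$ is $b$ for all large $t$, and $\hat b^{(\ell)}=b$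 for all large $\ell$. 2. (Partial asymptotic optimality) Almost surely, as $\ell\to\infty$, $$\Big|\frac{\alpha_{i,j}^{(\ell)}}{\sigma_{i,j}w^c_j}-\frac{\alpha_{i,j'}^{(\ell)}}{\sigma_{i,j'}w^c_{j'}}\Big|\to0\quad(i\ne b,\ 1\le j<j'\le D),$$ $$\Big|\Big(\frac{\alpha_{b,j}^{(\ell)}}{\sigma_{b,j}}\Big)^2-\sum_{i\ne b}\Big(\frac{\alpha_{i,j}^{(\ell)}}{\sigma_{i,j}}\Big)^2\Big|\to0\quad(1\le j\le D).$$ -/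

import Mathlib

open MeasureTheory ProbabilityTheory Filter Topology
open scoped ENNReal NNReal

noncomputable section

namespace IUOCBA

/-- The mixture `F^w = ∑ j, w j • F j` of the component distributions `F j`. -/
def mixture {D : ℕ} {Z : Type*} [MeasurableSpace Z] (F : Fin D → Measure Z)
    (w : Fin D → ℝ) : Measure Z :=
  ∑ j, ENNReal.ofReal (w j) • F j

/-- The Hellinger distance `(1 / √2) * ‖√p - √q‖₂`, where `p`, `q` are the densities of `P`, `Q`
with respect to the dominating measure `P + Q`. -/
def hellinger {Z : Type*} [MeasurableSpace Z] (P Q : Measure Z) : ℝ :=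
  (1 / √2) * (eLpNorm
    (fun z => √((P.rnDeriv (P + Q) z).toReal) - √((Q.rnDeriv (P + Q) z).toReal))
    2 (P + Q)).toReal

/-- Cumulative sum `a 1 + ⋯ + a t` of a sequence of stage-wise (batch or budget) sizes. -/
def cumul (a : ℕ → ℕ) (t : ℕ) : ℕ := ∑ τ ∈ Finset.Icc 1 t, a τ

/-- The stage in which the `ℓ`-th simulation (`ℓ ≥ 1`) is run: the largest stage `t ≥ 1` such that
fewer than `ℓ` simulations have been run before stage `t`. -/
def stage (n : ℕ → ℕ) (ℓ : ℕ) : ℕ := sSup {t | 1 ≤ t ∧ cumul n (t - 1) < ℓ}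

/-- The likelihood of the weight vector `w` given the first `M` terms of the input data `x`;
`f j` is the density of the `j`-th component. -/
def likelihood {D : ℕ} {Z : Type*} (f : Fin D → Z → ℝ≥0) (x : ℕ → Z) (M : ℕ)
    (w : Fin D → ℝ) : ℝ :=
  ∏ s ∈ Finset.range M, ∑ j, w j * (f j (x s) : ℝ)

/-- `w` is a maximum likelihood estimate of the weights from the first `M` input data. -/
def IsMLE {D : ℕ} {Z : Type*} (f : Fin D → Z → ℝ≥0) (x : ℕ → Z) (M : ℕ)
    (w : Fin D → ℝ) : Prop :=
  w ∈ stdSimplex ℝ (Fin D) ∧ IsMaxOn (likelihood f x M) (stdSimplex ℝ (Fin D)) w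

/-- Sample mean of the first `N` terms of `x`. -/
def sampleMean (x : ℕ → ℝ) (N : ℕ) : ℝ :=
  (1 / (N : ℝ)) * ∑ s ∈ Finset.range N, x s

/-- Sample standard deviation of the first `N` terms of `x`. -/
def sampleSD (x : ℕ → ℝ) (N : ℕ) : ℝ :=
  √((1 / ((N : ℝ) - 1)) * ∑ s ∈ Finset.range N, (x s - sampleMean x N) ^ 2)

/-- The quantities recorded along one execution of the sequential procedure that is never stopped.
Stages are numbered `t = 1, 2, …`; the replication counter is `l = 0, 1, …`, and iteration `l` runs
simulation number `l + 1`. -/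
structure Trajectory (K D : ℕ) where
  /-- weight estimate of stage `t` -/
  w : ℕ → Fin D → ℝ
  /-- number of simulations of each design-input pair when the replication counter is `l` -/
  N : ℕ → Fin K → Fin D → ℕ
  /-- estimated best design at iteration `l` -/
  bhat : ℕ → Fin K
  /-- input component minimizing the total balance gap at iteration `l` -/
  jstar : ℕ → Fin D
  /-- design simulated at iteration `l` -/
  I : ℕ → Fin K
  /-- input component simulated at iteration `l` -/
  J : ℕ → Fin D
  /-- design selected (output) if the procedure is stopped at the end of stage `t` -/
  sel : ℕ → Fin K

namespace Trajectory

variable {K D : ℕ} (T : Trajectory K D)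

/-- `N^(l)`: total number of simulations, initial ones included. -/
def total (l : ℕ) : ℕ := ∑ i, ∑ j, T.N l i j

/-- Allocation ratio of the pair `(i, j)`. -/
def ratio (l : ℕ) (i : Fin K) (j : Fin D) : ℝ := (T.N l i j : ℝ) / (T.total l : ℝ)

/-- Weight estimate in force at iteration `l`, which runs simulation number `l + 1`. -/
def wcur (n : ℕ → ℕ) (l : ℕ) : Fin D → ℝ := T.w (stage n (l + 1))

/-- Sample mean of the pair `(i, j)`; `X i j r` is the `r`-th simulation output of that pair. -/
def muPair (X : Fin K → Fin D → ℕ → ℝ) (l : ℕ) (i : Fin K) (j : Fin D) : ℝ :=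
  sampleMean (X i j) (T.N l i j)

/-- Sample standard deviation of the pair `(i, j)`. -/
def sdPair (X : Fin K → Fin D → ℕ → ℝ) (l : ℕ) (i : Fin K) (j : Fin D) : ℝ :=
  sampleSD (X i j) (T.N l i j)

/-- Estimated performance of design `i` at iteration `l`. -/
def muHat (n : ℕ → ℕ) (X : Fin K → Fin D → ℕ → ℝ) (l : ℕ) (i : Fin K) : ℝ :=
  ∑ j, T.wcur n l j * T.muPair X l i j

/-- Estimated performance of design `i` at the end of stage `t`. -/
def muStage (n : ℕ → ℕ) (X : Fin K → Fin D → ℕ → ℝ) (t : ℕ) (i : Fin K) : ℝ :=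
  ∑ j, T.w t j * T.muPair X (cumul n t) i j

/-- Total balance gap of component `j`. -/
def totalGap (X : Fin K → Fin D → ℕ → ℝ) (l : ℕ) (j : Fin D) : ℝ :=
  ((T.N l (T.bhat l) j : ℝ) / T.sdPair X l (T.bhat l) j) ^ 2
    - ∑ i ∈ Finset.univ.erase (T.bhat l), ((T.N l i j : ℝ) / T.sdPair X l i j) ^ 2

/-- The local balance statistic of design `i` against the estimated best design. -/
def localStat (n : ℕ → ℕ) (X : Fin K → Fin D → ℕ → ℝ) (l : ℕ) (i : Fin K) : ℝ :=
  (T.muHat n X l (T.bhat l) - T.muHat n X l i) ^ 2 /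
    (∑ j, (T.sdPair X l (T.bhat l) j) ^ 2 * (T.wcur n l j) ^ 2 / (T.N l (T.bhat l) j : ℝ)
      + ∑ j, (T.sdPair X l i j) ^ 2 * (T.wcur n l j) ^ 2 / (T.N l i j : ℝ))

/-- The input balance statistic of the pair `(i, j)`, with value `∞` if the estimated weight of
component `j` is zero. -/
def inputStat (n : ℕ → ℕ) (X : Fin K → Fin D → ℕ → ℝ) (l : ℕ) (i : Fin K) (j : Fin D) : ℝ≥0∞ :=
  (T.N l i j : ℝ≥0∞) / ENNReal.ofReal (T.sdPair X l i j * T.wcur n l j)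

/-- `T` is an execution of the procedure IU-OCBA-balance with initial sample size `n₀`, stage-wise
budgets `n` and stage-wise input batch sizes `m`, on the input data `x` and the simulation
outputs `X`. Ties in an `argmax` or `argmin` may be broken in any way. -/
structure IsBalanceRun {Z : Type*} (f : Fin D → Z → ℝ≥0) (n₀ : ℕ) (n m : ℕ → ℕ)
    (x : ℕ → Z) (X : Fin K → Fin D → ℕ → ℝ) : Prop where
  weight : ∀ t, 1 ≤ t → IsMLE f x (cumul m t) (T.w t)
  init : ∀ i j, T.N 0 i j = n₀
  bhat_max : ∀ l i, T.muHat n X l i ≤ T.muHat n X l (T.bhat l)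
  jstar_min : ∀ l j, T.totalGap X l (T.jstar l) ≤ T.totalGap X l j
  best : ∀ l, T.totalGap X l (T.jstar l) < 0 → T.I l = T.bhat l
  nonbest : ∀ l, ¬ T.totalGap X l (T.jstar l) < 0 →
    T.I l ≠ T.bhat l ∧ ∀ i, i ≠ T.bhat l → T.localStat n X l (T.I l) ≤ T.localStat n X l i
  input_min : ∀ l j, T.inputStat n X l (T.I l) (T.J l) ≤ T.inputStat n X l (T.I l) j
  step : ∀ l i j, T.N (l + 1) i j = if i = T.I l ∧ j = T.J l then T.N l i j + 1 else T.N l i j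
  sel_max : ∀ t, 1 ≤ t → ∀ i, T.muStage n X t i ≤ T.muStage n X t (T.sel t)

end Trajectory

/-- True expected performance `∑ j, w j * μ i j` of design `i` under the weights `w`. -/
def perf {K D : ℕ} (μ : Fin K → Fin D → ℝ) (w : Fin D → ℝ) (i : Fin K) : ℝ := ∑ j, w j * μ i j

end IUOCBA

end

/-! All randomness sits in the data. Outside a null set, the weight estimates converge, the sample
means and standard deviations converge as sample sizes grow, and the nondegeneracy conditions of
`Trajectory.IsRegularRun` hold. From there the argument is deterministic along one path, so the
adaptive choices need neither measurability nor independence.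

The weights converge by a Wald-type argument (`ae_tendsto_of_isMLE`): compactness of the simplex, a
countable cover, and the strong law for a bounded logarithmic criterion with strictly negative mean
away from `wc`.

The crux is that no pair is starved (`tendsto_N`). Each sample size is monotone, so it diverges or
freezes. Frozen sizes leave random limiting estimates that might tie, but there are only countably
many patterns of frozen sizes, and in each a tie is either a nontrivial linear relation between
independent Gaussians or excluded by `hdist` (`ae_limit_perf_ne`). Hence the estimated best design
settles at some `c`. The total balance test then prevents `c`, and also the designs other than `c`
as a group, from being starved; the local statistic protects each individual design; the input rule
spreads this over the components. Once every size diverges, the estimates are consistent and `c` is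
`b`.

Both balance claims are barrier arguments. A pair is simulated only when its normalised size is
minimal within its design, so it overshoots the others by at most one sample, up to estimation
error. The total gap is pushed back whenever it is large, and one step moves it by O(total),
negligible against total². The test only sees the sign of the minimum over components; input
balance, applied to `b` as well, makes the gaps divided by `wc j ^ 2` asymptotically equal, so this
sign controls every component (`eventually_abs_trueGap_le`). -/

namespace IUOCBA

/-! ### Strong consistency of the maximum likelihood weights. -/

section MLE

variable {D : ℕ} {Z : Type*}

/-- Density of the mixture with weights `w` of components with densities `g`. -/
noncomputable def mixDens (g : Fin D → Z → ℝ≥0) (w : Fin D → ℝ) (z : Z) : ℝ≥0 :=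
  ∑ j, (w j).toNNReal * g j z

/-- Density of the `j`-th component with respect to the mixture with weights `wc`. -/
noncomputable def densRatio (f : Fin D → Z → ℝ≥0) (wc : Fin D → ℝ) (j : Fin D) (z : Z) : ℝ≥0 :=
  f j z / mixDens f wc z

/-- Logarithm of the density of the midpoint of the mixtures with weights `w` and `wc`, with respect
to the mixture with weights `wc`. -/
noncomputable def logMid (f : Fin D → Z → ℝ≥0) (wc w : Fin D → ℝ) (z : Z) : ℝ :=
  Real.log ((1 + ∑ j, w j * (densRatio f wc j z : ℝ)) / 2)

lemma coe_mixDens (g : Fin D → Z → ℝ≥0) {w : Fin D → ℝ} (hw : ∀ j, 0 ≤ w j) (z : Z) :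
    (mixDens g w z : ℝ) = ∑ j, w j * (g j z : ℝ) := by
  simp [mixDens, Real.coe_toNNReal _ (hw _)]

/-- Where the mixture density vanishes, so does every component, since all weights are positive;
division by zero is therefore harmless. -/
lemma mixDens_mul_densRatio (f : Fin D → Z → ℝ≥0) {wc : Fin D → ℝ} (hwc : ∀ j, 0 < wc j)
    (j : Fin D) (z : Z) : mixDens f wc z * densRatio f wc j z = f j z := by
  unfold densRatio
  by_cases h : mixDens f wc z = 0
  · have h1 : ∀ k ∈ Finset.univ, (wc k).toNNReal * f k z = 0 := by
      have := h
      unfold mixDens at this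
      rwa [Finset.sum_eq_zero_iff] at this
    have h2 := h1 j (Finset.mem_univ j)
    have h3 : f j z = 0 := by
      rcases mul_eq_zero.1 h2 with h | h
      · exact absurd h (Real.toNNReal_pos.2 (hwc j)).ne'
      · exact h
    rw [h, h3]; simp
  · exact mul_div_cancel₀ _ h

lemma densRatio_le (f : Fin D → Z → ℝ≥0) {wc : Fin D → ℝ} (hwc : ∀ j, 0 < wc j)
    (j : Fin D) (z : Z) : (densRatio f wc j z : ℝ) ≤ 1 / wc j := by
  have h0 : (mixDens f wc z : ℝ) = ∑ j, wc j * (f j z : ℝ) :=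
    coe_mixDens f (fun j => (hwc j).le) z
  have h1 : wc j * (f j z : ℝ) ≤ mixDens f wc z := by
    rw [h0]
    exact Finset.single_le_sum (f := fun j => wc j * (f j z : ℝ))
      (fun k _ => mul_nonneg (hwc k).le (NNReal.coe_nonneg (f k z))) (Finset.mem_univ j)
  unfold densRatio
  rw [NNReal.coe_div]
  rcases (NNReal.coe_nonneg (mixDens f wc z)).eq_or_lt with h | h
  · have : (mixDens f wc z : ℝ) = 0 := h.symm
    rw [this, div_zero]; exact (one_div_pos.2 (hwc j)).le
  · rw [div_le_div_iff₀ h (hwc j)]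
    linarith

lemma measurable_mixDens [MeasurableSpace Z] {g : Fin D → Z → ℝ≥0} (hg : ∀ j, Measurable (g j))
    (w : Fin D → ℝ) : Measurable (mixDens g w) := by
  unfold mixDens
  fun_prop

lemma measurable_densRatio [MeasurableSpace Z] {f : Fin D → Z → ℝ≥0} (hf : ∀ j, Measurable (f j))
    (wc : Fin D → ℝ) (j : Fin D) : Measurable (densRatio f wc j) := by
  unfold densRatio
  exact (hf j).div (measurable_mixDens hf wc)

lemma measurable_logMid [MeasurableSpace Z] {f : Fin D → Z → ℝ≥0} (hf : ∀ j, Measurable (f j))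
    (wc w : Fin D → ℝ) : Measurable (logMid f wc w) := by
  have := measurable_densRatio hf wc
  unfold logMid
  fun_prop

lemma mixture_eq_withDensity [MeasurableSpace Z] {F : Fin D → Measure Z} {κ : Measure Z}
    {g : Fin D → Z → ℝ≥0} (hg : ∀ j, Measurable (g j))
    (hF : ∀ j, F j = κ.withDensity (fun z => (g j z : ℝ≥0∞))) (w : Fin D → ℝ) :
    mixture F w = κ.withDensity (fun z => (mixDens g w z : ℝ≥0∞)) := by
  ext s hs
  rw [withDensity_apply _ hs]
  unfold mixture mixDens
  simp only [Measure.coe_finsetSum, Finset.sum_apply, Measure.smul_apply, smul_eq_mul]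
  push_cast
  rw [lintegral_finsetSum]
  · refine Finset.sum_congr rfl fun j _ => ?_
    rw [lintegral_const_mul, hF, withDensity_apply _ hs]
    · rfl
    · exact (hg j).coe_nnreal_ennreal
  · intro j _
    have := hg j
    fun_prop

lemma component_eq_withDensity_mixture [MeasurableSpace Z] {F : Fin D → Measure Z} {ν : Measure Z}
    {f : Fin D → Z → ℝ≥0} (hf : ∀ j, Measurable (f j))
    (hF : ∀ j, F j = ν.withDensity (fun z => (f j z : ℝ≥0∞)))
    {wc : Fin D → ℝ} (hwc : ∀ j, 0 < wc j) (j : Fin D) :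
    F j = (mixture F wc).withDensity (fun z => (densRatio f wc j z : ℝ≥0∞)) := by
  rw [mixture_eq_withDensity hf hF, ← withDensity_mul _
    (measurable_mixDens hf wc).coe_nnreal_ennreal
    (measurable_densRatio hf wc j).coe_nnreal_ennreal, hF]
  congr 1
  ext z
  rw [Pi.mul_apply, ← ENNReal.coe_mul, mixDens_mul_densRatio f hwc]

lemma isProbabilityMeasure_mixture [MeasurableSpace Z] (F : Fin D → Measure Z)
    [∀ j, IsProbabilityMeasure (F j)] {w : Fin D → ℝ} (hw : ∀ j, 0 ≤ w j) (hsum : ∑ j, w j = 1) :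
    IsProbabilityMeasure (mixture F w) := by
  constructor
  unfold mixture
  simp only [Measure.coe_finsetSum, Finset.sum_apply, Measure.smul_apply, smul_eq_mul,
    measure_univ, mul_one]
  rw [← ENNReal.ofReal_sum_of_nonneg fun j _ => hw j, hsum, ENNReal.ofReal_one]

lemma hellinger_self [MeasurableSpace Z] (Q : Measure Z) : hellinger Q Q = 0 := by
  unfold hellinger
  simp only [sub_self]
  have : (fun _ : Z => (0 : ℝ)) = 0 := rfl
  rw [this, eLpNorm_zero]
  simp

lemma sum_mul_densRatio_nonneg (f : Fin D → Z → ℝ≥0) (wc : Fin D → ℝ) {w : Fin D → ℝ}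
    (hw : w ∈ stdSimplex ℝ (Fin D)) (z : Z) : 0 ≤ ∑ j, w j * (densRatio f wc j z : ℝ) :=
  Finset.sum_nonneg fun j _ => mul_nonneg (hw.1 j) (NNReal.coe_nonneg (densRatio f wc j z))

lemma sum_mul_densRatio_le (f : Fin D → Z → ℝ≥0) {wc : Fin D → ℝ} (hwc : ∀ j, 0 < wc j)
    {w : Fin D → ℝ} (hw : w ∈ stdSimplex ℝ (Fin D)) (z : Z) :
    ∑ j, w j * (densRatio f wc j z : ℝ) ≤ ∑ j, w j * (1 / wc j) :=
  Finset.sum_le_sum fun j _ => mul_le_mul_of_nonneg_left (densRatio_le f hwc j z) (hw.1 j)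

/-- The halves cancel in the difference, and log is 1-Lipschitz on [1, ∞). -/
lemma abs_log_sub_log_le {a b : ℝ} (ha : 1 ≤ a) (hb : 1 ≤ b) :
    |Real.log (a / 2) - Real.log (b / 2)| ≤ |a - b| := by
  wlog hab : b ≤ a generalizing a b
  · rw [abs_sub_comm, abs_sub_comm a]
    exact this hb ha (le_of_not_ge hab)
  have hb0 : 0 < b / 2 := by linarith
  have ha0 : 0 < a / 2 := by linarith
  rw [abs_of_nonneg (sub_nonneg.2 (Real.log_le_log hb0 (by linarith))),
    abs_of_nonneg (sub_nonneg.2 hab), ← Real.log_div ha0.ne' hb0.ne']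
  refine (Real.log_le_sub_one_of_pos (by positivity)).trans ?_
  have : a / 2 / (b / 2) - 1 = (a - b) / b := by field_simp
  rw [this]
  exact div_le_self (by linarith) hb

lemma abs_logMid_sub_le (f : Fin D → Z → ℝ≥0) {wc : Fin D → ℝ} (hwc : ∀ j, 0 < wc j)
    {w v : Fin D → ℝ} (hw : w ∈ stdSimplex ℝ (Fin D)) (hv : v ∈ stdSimplex ℝ (Fin D)) (z : Z) :
    |logMid f wc w z - logMid f wc v z| ≤ (∑ j, 1 / wc j) * dist w v := by
  unfold logMid
  refine (abs_log_sub_log_le (by linarith [sum_mul_densRatio_nonneg f wc hw z])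
    (by linarith [sum_mul_densRatio_nonneg f wc hv z])).trans ?_
  rw [add_sub_add_left_eq_sub, ← Finset.sum_sub_distrib, Finset.sum_mul]
  refine (Finset.abs_sum_le_sum_abs _ _).trans (Finset.sum_le_sum fun j _ => ?_)
  rw [← sub_mul, abs_mul, mul_comm, abs_of_nonneg (NNReal.coe_nonneg (densRatio f wc j z))]
  refine mul_le_mul (densRatio_le f hwc j z) ?_ (abs_nonneg _) (one_div_pos.2 (hwc j)).le
  rw [← Real.dist_eq]
  exact dist_le_pi_dist w v j

lemma abs_logMid_le (f : Fin D → Z → ℝ≥0) {wc : Fin D → ℝ} (hwc : ∀ j, 0 < wc j)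
    {w : Fin D → ℝ} (hw : w ∈ stdSimplex ℝ (Fin D)) (z : Z) :
    |logMid f wc w z| ≤ 1 + ∑ j, w j * (1 / wc j) := by
  have h0 := sum_mul_densRatio_nonneg f wc hw z
  have h1 := sum_mul_densRatio_le f hwc hw z
  have h2 := abs_log_sub_log_le (a := 1 + ∑ j, w j * (densRatio f wc j z : ℝ)) (b := 2)
    (by linarith) (by norm_num)
  have h3 : Real.log (2 / 2 : ℝ) = 0 := by norm_num
  rw [h3, sub_zero] at h2
  unfold logMid
  refine h2.trans (abs_le.2 ⟨?_, ?_⟩) <;> linarith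

/-- Maximality gives `∏ r ≥ 1` for the density ratios `r`, and `r ≤ ((1 + r) / 2) ^ 2` carries this
over to the midpoint. Unlike `log r`, the midpoint logarithm stays bounded when `r` vanishes. -/
lemma sum_logMid_nonneg_of_isMLE {f : Fin D → Z → ℝ≥0} {wc : Fin D → ℝ}
    (hwc : ∀ j, 0 < wc j) (hwc_sum : ∑ j, wc j = 1)
    {x : ℕ → Z} (hx : ∀ s, mixDens f wc (x s) ≠ 0) {M : ℕ} {w : Fin D → ℝ}
    (hw : IsMLE f x M w) : 0 ≤ ∑ s ∈ Finset.range M, logMid f wc w (x s) := by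
  have hwcs : wc ∈ stdSimplex ℝ (Fin D) := ⟨fun j => (hwc j).le, hwc_sum⟩
  have h1 : likelihood f x M wc ≤ likelihood f x M w := hw.2 hwcs
  let r : ℕ → ℝ := fun s => ∑ j, w j * (densRatio f wc j (x s) : ℝ)
  have hr0 : ∀ s, 0 ≤ r s := fun s => sum_mul_densRatio_nonneg f wc hw.1 (x s)
  have hpos : ∀ s, 0 < ∑ j, wc j * (f j (x s) : ℝ) := fun s => by
    rw [← coe_mixDens f (fun j => (hwc j).le)]
    exact NNReal.coe_pos.2 (pos_iff_ne_zero.2 (hx s))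
  have hfac : ∀ s, ∑ j, w j * (f j (x s) : ℝ) = (∑ j, wc j * (f j (x s) : ℝ)) * r s := fun s => by
    rw [Finset.mul_sum, ← coe_mixDens f (fun j => (hwc j).le)]
    refine Finset.sum_congr rfl fun j _ => ?_
    rw [← mixDens_mul_densRatio f hwc j (x s)]
    push_cast
    ring
  have h2 : 1 ≤ ∏ s ∈ Finset.range M, r s := by
    unfold likelihood at h1
    simp only [hfac, Finset.prod_mul_distrib] at h1
    exact (le_mul_iff_one_le_right (Finset.prod_pos fun s _ => hpos s)).1 h1
  have h3 : 1 ≤ (∏ s ∈ Finset.range M, ((1 + r s) / 2)) ^ 2 := by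
    rw [← Finset.prod_pow]
    refine h2.trans (Finset.prod_le_prod (fun s _ => hr0 s) fun s _ => ?_)
    nlinarith [sq_nonneg (1 - r s)]
  have h4 : 0 ≤ ∏ s ∈ Finset.range M, ((1 + r s) / 2) :=
    Finset.prod_nonneg fun s _ => by linarith [hr0 s]
  have h5 : 1 ≤ ∏ s ∈ Finset.range M, ((1 + r s) / 2) := by nlinarith
  have h6 : ∑ s ∈ Finset.range M, logMid f wc w (x s)
      = Real.log (∏ s ∈ Finset.range M, ((1 + r s) / 2)) := by
    rw [Real.log_prod fun s _ => by linarith [hr0 s]]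
    rfl
  rw [h6]
  exact Real.log_nonneg h5

lemma ae_mixDens_ne_zero [MeasurableSpace Z] {F : Fin D → Measure Z} {ν : Measure Z}
    {f : Fin D → Z → ℝ≥0} {wc : Fin D → ℝ} (hf : ∀ j, Measurable (f j))
    (hF : ∀ j, F j = ν.withDensity (fun z => (f j z : ℝ≥0∞))) :
    ∀ᵐ z ∂(mixture F wc), mixDens f wc z ≠ 0 := by
  rw [mixture_eq_withDensity hf hF,
    ae_withDensity_iff (measurable_mixDens hf wc).coe_nnreal_ennreal]
  exact ae_of_all _ fun z hz => by simpa using hz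

variable [MeasurableSpace Z] {F : Fin D → Measure Z} [∀ j, IsProbabilityMeasure (F j)]
  {ν : Measure Z} {f : Fin D → Z → ℝ≥0} {wc : Fin D → ℝ}

lemma integrable_densRatio (hf : ∀ j, Measurable (f j))
    (hwc : ∀ j, 0 < wc j) (Q : Measure Z) [IsFiniteMeasure Q] (j : Fin D) :
    Integrable (fun z => (densRatio f wc j z : ℝ)) Q := by
  refine Integrable.of_bound (C := 1 / wc j)
    (measurable_densRatio hf wc j).coe_nnreal_real.aestronglyMeasurable (ae_of_all _ fun z => ?_)
  rw [Real.norm_eq_abs, abs_of_nonneg (NNReal.coe_nonneg (densRatio f wc j z))]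
  exact densRatio_le f hwc j z

lemma integral_densRatio (hf : ∀ j, Measurable (f j))
    (hF : ∀ j, F j = ν.withDensity (fun z => (f j z : ℝ≥0∞)))
    (hwc : ∀ j, 0 < wc j) (j : Fin D) :
    ∫ z, (densRatio f wc j z : ℝ) ∂(mixture F wc) = 1 := by
  have h := component_eq_withDensity_mixture hf hF hwc j
  rw [integral_eq_lintegral_of_nonneg_ae (ae_of_all _ fun z => (NNReal.coe_nonneg (densRatio f wc j z)))
    (measurable_densRatio hf wc j).coe_nnreal_real.aestronglyMeasurable]
  have h1 : (F j) Set.univ = 1 := measure_univ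
  rw [h, withDensity_apply _ MeasurableSet.univ, Measure.restrict_univ] at h1
  simp only [ENNReal.ofReal_coe_nnreal]
  rw [h1]; rfl

lemma integrable_logMid (hf : ∀ j, Measurable (f j)) (hwc : ∀ j, 0 < wc j)
    (Q : Measure Z) [IsFiniteMeasure Q] {w : Fin D → ℝ} (hw : w ∈ stdSimplex ℝ (Fin D)) :
    Integrable (logMid f wc w) Q :=
  Integrable.of_bound (measurable_logMid hf wc w).aestronglyMeasurable
    (C := 1 + ∑ j, w j * (1 / wc j)) (ae_of_all _ fun z => abs_logMid_le f hwc hw z)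

lemma integral_logMid_neg (hf : ∀ j, Measurable (f j))
    (hF : ∀ j, F j = ν.withDensity (fun z => (f j z : ℝ≥0∞)))
    (hwc : ∀ j, 0 < wc j) (hwc_sum : ∑ j, wc j = 1)
    {w : Fin D → ℝ} (hw : w ∈ stdSimplex ℝ (Fin D))
    (hne : hellinger (mixture F w) (mixture F wc) ≠ 0) :
    ∫ z, logMid f wc w z ∂(mixture F wc) < 0 := by
  have := isProbabilityMeasure_mixture F (fun j => (hwc j).le) hwc_sum
  set Q := mixture F wc with hQ
  let r : Z → ℝ := fun z => ∑ j, w j * (densRatio f wc j z : ℝ)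
  have hr0 : ∀ z, 0 ≤ r z := fun z => sum_mul_densRatio_nonneg f wc hw z
  have hri : Integrable r Q :=
    integrable_finsetSum _ fun j _ => (integrable_densRatio hf hwc Q j).const_mul _
  have hr1 : ∫ z, r z ∂Q = 1 := by
    show ∫ z, ∑ j, w j * (densRatio f wc j z : ℝ) ∂Q = 1
    rw [integral_finsetSum _ fun j _ => (integrable_densRatio hf hwc Q j).const_mul _]
    simp only [integral_const_mul, hQ, integral_densRatio hf hF hwc, mul_one]
    exact hw.2
  have hgi := integrable_logMid hf hwc Q hw
  -- The slack in `log y ≤ y - 1` at `y = (1 + r) / 2`. As `r` has mean 1, a zero integral of `h`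
  -- would force `r = 1` almost everywhere, hence equal mixtures.
  let h : Z → ℝ := fun z => (r z - 1) / 2 - logMid f wc w z
  have hhi : Integrable h Q := ((hri.sub (integrable_const 1)).div_const 2).sub hgi
  have hh0 : 0 ≤ h := fun z => by
    have := Real.log_le_sub_one_of_pos (x := (1 + r z) / 2) (by linarith [hr0 z])
    show 0 ≤ (r z - 1) / 2 - Real.log ((1 + r z) / 2)
    linarith
  have hint : ∫ z, h z ∂Q = - ∫ z, logMid f wc w z ∂Q := by
    show ∫ z, ((r z - 1) / 2 - logMid f wc w z) ∂Q = _
    have hri1 : Integrable (fun z => r z - 1) Q := hri.sub (integrable_const 1)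
    rw [integral_sub (hri1.div_const 2) hgi, integral_div,
      integral_sub hri (integrable_const 1), hr1]
    simp
  have hnn : 0 ≤ ∫ z, h z ∂Q := integral_nonneg hh0
  by_contra hcon
  have hz : ∫ z, h z ∂Q = 0 := by linarith
  rw [integral_eq_zero_iff_of_nonneg hh0 hhi] at hz
  have hr : ∀ᵐ z ∂Q, r z = 1 := by
    filter_upwards [hz] with z hz
    by_contra hne
    have := Real.log_lt_sub_one_of_pos (x := (1 + r z) / 2) (by linarith [hr0 z])
      (fun h => hne (by linarith))
    have h2 : (r z - 1) / 2 - Real.log ((1 + r z) / 2) = 0 := hz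
    linarith
  apply hne
  have heq : mixture F w = Q := by
    -- The base measure is now `Q` itself, with component densities `densRatio`.
    rw [mixture_eq_withDensity (measurable_densRatio hf wc)
      (component_eq_withDensity_mixture hf hF hwc) w, ← hQ]
    have : (fun z => (mixDens (densRatio f wc) w z : ℝ≥0∞)) =ᵐ[Q] 1 := by
      filter_upwards [hr] with z hz
      have h2 := coe_mixDens (densRatio f wc) hw.1 z
      have h3 : mixDens (densRatio f wc) w z = 1 := by
        apply NNReal.coe_injective
        rw [h2]; exact hz
      simp [h3]
    rw [withDensity_congr_ae this, withDensity_one]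
  rw [heq]
  exact hellinger_self Q

/-- Strong consistency of the maximum likelihood estimator of the mixture weights. -/
theorem ae_tendsto_of_isMLE {Ω : Type*} [MeasurableSpace Ω] {P : Measure Ω} [IsProbabilityMeasure P]
    (hf : ∀ j, Measurable (f j))
    (hF : ∀ j, F j = ν.withDensity (fun z => (f j z : ℝ≥0∞)))
    (hwc : ∀ j, 0 < wc j) (hwc_sum : ∑ j, wc j = 1)
    (hident : ∀ w ∈ stdSimplex ℝ (Fin D), w ≠ wc →
      hellinger (mixture F w) (mixture F wc) ≠ 0)
    {ξ : ℕ → Ω → Z} (hξ_meas : ∀ s, Measurable (ξ s))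
    (hξ_law : ∀ s, P.map (ξ s) = mixture F wc) (hξ_indep : iIndepFun ξ P) :
    ∀ᵐ ω ∂P, ∀ (M : ℕ → ℕ) (w : ℕ → Fin D → ℝ), Tendsto M atTop atTop →
      (∀ᶠ t in atTop, IsMLE f (fun s => ξ s ω) (M t) (w t)) → Tendsto w atTop (𝓝 wc) := by
  have := isProbabilityMeasure_mixture F (fun j => (hwc j).le) hwc_sum
  let L : ℝ := ∑ j, 1 / wc j
  have hL : 0 ≤ L := Finset.sum_nonneg fun j _ => (one_div_pos.2 (hwc j)).le
  let G : (Fin D → ℝ) → ℝ := fun w => ∫ z, logMid f wc w z ∂(mixture F wc)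
  let S : Set (Fin D → ℝ) := stdSimplex ℝ (Fin D) \ {wc}
  have hG : ∀ w ∈ S, G w < 0 := fun w hw =>
    integral_logMid_neg hf hF hwc hwc_sum hw.1 (hident w hw.1 hw.2)
  -- On this ball the Lipschitz error uses up at most half of the negative mean `G w`. Countably
  -- many balls cover the simplex without `wc`, so the strong law is needed only at their centres.
  let U : (Fin D → ℝ) → Set (Fin D → ℝ) := fun w => {v | L * dist v w < - G w / 2}
  have hU : ∀ w ∈ S, IsOpen (U w) ∧ w ∈ U w := fun w hw => by
    refine ⟨isOpen_lt (by fun_prop) continuous_const, ?_⟩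
    show L * dist w w < - G w / 2
    rw [dist_self]; linarith [hG w hw]
  obtain ⟨C, hCS, hCc, hCcov⟩ := TopologicalSpace.countable_cover_nhdsWithin (f := U) (s := S)
    fun w hw => mem_nhdsWithin_of_mem_nhds ((hU w hw).1.mem_nhds (hU w hw).2)
  have hlln : ∀ w ∈ C, ∀ᵐ ω ∂P, Tendsto
      (fun n : ℕ => (∑ s ∈ Finset.range n, logMid f wc w (ξ s ω)) / n) atTop (𝓝 (G w)) := by
    intro w hw
    have hm := measurable_logMid hf wc w
    have hid : ∀ s, IdentDistrib (ξ s) (ξ 0) P P := fun s =>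
      ⟨(hξ_meas s).aemeasurable, (hξ_meas 0).aemeasurable, by rw [hξ_law, hξ_law]⟩
    have h := strong_law_ae_real (μ := P) (fun s ω => logMid f wc w (ξ s ω))
      (by
        have h := integrable_logMid hf hwc (P.map (ξ 0)) (hCS hw).1
        exact h.comp_measurable (hξ_meas 0))
      (fun s t hst => (hξ_indep.indepFun hst).comp hm hm)
      (fun s => (hid s).comp hm)
    have hI : ∫ ω, logMid f wc w (ξ 0 ω) ∂P = G w := by
      show _ = ∫ z, logMid f wc w z ∂(mixture F wc)
      rw [← hξ_law 0, integral_map (hξ_meas 0).aemeasurable hm.aestronglyMeasurable]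
    rwa [hI] at h
  have hpos : ∀ᵐ ω ∂P, ∀ s, mixDens f wc (ξ s ω) ≠ 0 := by
    rw [ae_all_iff]
    intro s
    have h := ae_mixDens_ne_zero (wc := wc) hf hF
    rw [← hξ_law s] at h
    exact ae_of_ae_map (hξ_meas s).aemeasurable h
  have hall := (ae_ball_iff hCc).2 hlln
  filter_upwards [hall, hpos] with ω hω hω0
  intro M w hM hw
  refine (isCompact_stdSimplex ℝ (Fin D)).tendsto_nhds_of_unique_mapClusterPt
    (hw.mono fun t ht => ht.1) ?_
  intro v hv hcl
  by_contra hne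
  obtain ⟨u, huC, hvu⟩ : ∃ u ∈ C, v ∈ U u := by
    have h := hCcov (show v ∈ S from ⟨hv, hne⟩)
    simpa using h
  have hfr := mapClusterPt_iff_frequently.1 hcl (U u) ((hU u (hCS huC)).1.mem_nhds hvu)
  have hlt : ∀ᶠ n : ℕ in atTop,
      (∑ s ∈ Finset.range n, logMid f wc u (ξ s ω)) / n < G u / 2 :=
    (hω u huC).eventually_lt_const (by linarith [hG u (hCS huC)])
  have hev := (hM.eventually hlt).and (hw.and (hM.eventually_gt_atTop 0))
  obtain ⟨t, htU, ht1, ht2, ht3⟩ := (hfr.and_eventually hev).exists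
  have hMpos : (0 : ℝ) < M t := Nat.cast_pos.2 ht3
  rw [div_lt_iff₀ hMpos] at ht1
  have h0 := sum_logMid_nonneg_of_isMLE hwc hwc_sum hω0 ht2
  have hd : ∑ s ∈ Finset.range (M t), logMid f wc (w t) (ξ s ω)
      ≤ ∑ s ∈ Finset.range (M t), (logMid f wc u (ξ s ω) + L * dist (w t) u) := by
    refine Finset.sum_le_sum fun s _ => ?_
    have := (abs_le.1 (abs_logMid_sub_le f hwc ht2.1 (hCS huC).1 (ξ s ω))).2
    linarith
  rw [Finset.sum_add_distrib, Finset.sum_const, Finset.card_range, nsmul_eq_mul] at hd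
  have hU' : L * dist (w t) u < - G u / 2 := htU
  nlinarith

end MLE

end IUOCBA

/-! ### Sample means and deviations; absence of ties between limiting estimates. -/

namespace IUOCBA

section SampleStatistics

lemma sampleMean_eq_div (x : ℕ → ℝ) (N : ℕ) :
    sampleMean x N = (∑ s ∈ Finset.range N, x s) / N := by
  unfold sampleMean
  ring

lemma sampleSD_eq_sqrt (x : ℕ → ℝ) {N : ℕ} (hN : 2 ≤ N) :
    sampleSD x N = √((N : ℝ) / ((N : ℝ) - 1) *
      ((∑ s ∈ Finset.range N, x s ^ 2) / N - sampleMean x N ^ 2)) := by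
  unfold sampleSD
  have hN0 : (N : ℝ) ≠ 0 := by positivity
  congr 1
  have h : ∑ s ∈ Finset.range N, (x s - sampleMean x N) ^ 2
      = N * ((∑ s ∈ Finset.range N, x s ^ 2) / N - sampleMean x N ^ 2) := by
    have h1 : ∑ s ∈ Finset.range N, x s = N * sampleMean x N := by
      rw [sampleMean_eq_div]; field_simp
    simp only [sub_sq, Finset.sum_add_distrib, Finset.sum_sub_distrib]
    rw [← Finset.sum_mul, ← Finset.mul_sum, h1]
    simp only [Finset.sum_const, Finset.card_range, nsmul_eq_mul]
    field_simp
    ring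
  rw [h]
  ring

lemma tendsto_sampleSD {x : ℕ → ℝ} {a c : ℝ}
    (h1 : Tendsto (fun n : ℕ => (∑ s ∈ Finset.range n, x s) / n) atTop (𝓝 a))
    (h2 : Tendsto (fun n : ℕ => (∑ s ∈ Finset.range n, x s ^ 2) / n) atTop (𝓝 c)) :
    Tendsto (sampleSD x) atTop (𝓝 √(c - a ^ 2)) := by
  have h3 : Tendsto (fun n : ℕ => (n : ℝ) / ((n : ℝ) - 1)) atTop (𝓝 1) := by
    have := tendsto_natCast_div_add_atTop (𝕜 := ℝ) (-1)
    simpa [sub_eq_add_neg] using this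
  have h4 := (h3.mul (h2.sub (h1.pow 2))).sqrt
  rw [one_mul] at h4
  refine h4.congr' ?_
  filter_upwards [eventually_ge_atTop 2] with n hn
  rw [sampleSD_eq_sqrt x hn, sampleMean_eq_div]

/-- Two distinct observations cannot both equal the mean, so one almost sure condition serves all
sample sizes. -/
lemma sampleSD_pos {x : ℕ → ℝ} (hx : x 0 ≠ x 1) {N : ℕ} (hN : 2 ≤ N) : 0 < sampleSD x N := by
  unfold sampleSD
  have hN1 : (0 : ℝ) < (N : ℝ) - 1 := by
    have : (2 : ℝ) ≤ N := by exact_mod_cast hN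
    linarith
  refine Real.sqrt_pos.2 (mul_pos (one_div_pos.2 hN1) ?_)
  refine Finset.sum_pos' (fun s _ => sq_nonneg _) ?_
  by_cases h : x 0 = sampleMean x N
  · exact ⟨1, Finset.mem_range.2 (by omega),
      sq_pos_iff.2 (sub_ne_zero.2 fun h' => hx (h.trans h'.symm))⟩
  · exact ⟨0, Finset.mem_range.2 (by omega), sq_pos_iff.2 (sub_ne_zero.2 h)⟩

variable {Ω : Type*} [MeasurableSpace Ω] {P : Measure Ω} [IsProbabilityMeasure P]

lemma ae_tendsto_sample_of_gaussian {Y : ℕ → Ω → ℝ} (hY : ∀ r, Measurable (Y r)) {a s : ℝ}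
    (hs : 0 < s) (hlaw : ∀ r, P.map (Y r) = gaussianReal a (s ^ 2).toNNReal)
    (hind : Pairwise (Function.onFun (fun f g => IndepFun f g P) Y)) :
    ∀ᵐ ω ∂P, Tendsto (sampleMean fun r => Y r ω) atTop (𝓝 a) ∧
      Tendsto (sampleSD fun r => Y r ω) atTop (𝓝 s) := by
  have hmem : MemLp (Y 0) 2 P := by
    have h : MemLp id 2 (P.map (Y 0)) := by
      rw [hlaw]; exact memLp_id_gaussianReal 2
    exact (memLp_map_measure_iff aestronglyMeasurable_id (hY 0).aemeasurable).1 h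
  have hint : Integrable (Y 0) P := hmem.integrable (by norm_num)
  have hmean : ∫ ω, Y 0 ω ∂P = a := by
    have h := integral_map (μ := P) (hY 0).aemeasurable (f := fun x : ℝ => x)
      aestronglyMeasurable_id
    rw [hlaw, integral_id_gaussianReal] at h
    exact h.symm
  have hvar : Var[Y 0; P] = s ^ 2 := by
    have h := variance_map (μ := P) (X := id) (Y := Y 0) aemeasurable_id (hY 0).aemeasurable
    rw [hlaw, variance_id_gaussianReal] at h
    have h2 : Var[Y 0; P] = ((s ^ 2).toNNReal : ℝ) := h.symm
    rw [h2, Real.coe_toNNReal _ (sq_nonneg s)]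
  have hsq : ∫ ω, Y 0 ω ^ 2 ∂P = s ^ 2 + a ^ 2 := by
    have h := variance_eq_sub hmem
    rw [hvar, hmean] at h
    have h2 : P[Y 0 ^ 2] = ∫ ω, Y 0 ω ^ 2 ∂P := rfl
    rw [h2] at h
    linarith
  have hid : ∀ r, IdentDistrib (Y r) (Y 0) P P := fun r =>
    ⟨(hY r).aemeasurable, (hY 0).aemeasurable, by rw [hlaw, hlaw]⟩
  have hm2 : Measurable fun x : ℝ => x ^ 2 := by fun_prop
  have h1 := strong_law_ae_real Y hint hind hid
  have h2 := strong_law_ae_real (μ := P) (fun r ω => Y r ω ^ 2) hmem.integrable_sq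
    (fun r t hrt => (hind hrt).comp hm2 hm2) (fun r => (hid r).comp hm2)
  filter_upwards [h1, h2] with ω h1 h2
  rw [hmean] at h1
  rw [hsq] at h2
  refine ⟨h1.congr fun n => (sampleMean_eq_div _ n).symm, ?_⟩
  have h := tendsto_sampleSD h1 h2
  rwa [add_sub_cancel_right, Real.sqrt_sq hs.le] at h

/-- By Fubini the diagonal is null for the product law: its slices are singletons, and `V` has no
atoms. -/
lemma ae_ne_of_indepFun {U V : Ω → ℝ} (hU : Measurable U) (hV : Measurable V)
    (h : IndepFun U V P) [NullSingletonClass (P.map V)] : ∀ᵐ ω ∂P, U ω ≠ V ω := by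
  have hmap := (indepFun_iff_map_prod_eq_prod_map_map hU.aemeasurable hV.aemeasurable).1 h
  have hms : MeasurableSet {p : ℝ × ℝ | p.1 = p.2} := measurableSet_eq_fun measurable_fst measurable_snd
  have h0 : ((P.map U).prod (P.map V)) {p : ℝ × ℝ | p.1 = p.2} = 0 := by
    rw [Measure.measure_prod_null hms]
    refine ae_of_all _ fun x => ?_
    have : Prod.mk x ⁻¹' {p : ℝ × ℝ | p.1 = p.2} = {x} := by
      ext y; simp [eq_comm]
    show P.map V (Prod.mk x ⁻¹' {p : ℝ × ℝ | p.1 = p.2}) = 0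
    rw [this, measure_singleton]
  rw [← hmap, Measure.map_apply (hU.prodMk hV) hms] at h0
  rw [ae_iff]
  simpa using h0

/-- A nontrivial linear combination of independent random variables without atoms has no atoms. -/
lemma ae_sum_mul_ne {ι : Type*} {Y : ι → Ω → ℝ} (hY : ∀ p, Measurable (Y p))
    (hind : iIndepFun Y P) (hatom : ∀ p, NullSingletonClass (P.map (Y p)))
    (S : Finset ι) (c : ι → ℝ) {p₀ : ι} (hp₀ : p₀ ∈ S) (hc : c p₀ ≠ 0) (d : ℝ) :
    ∀ᵐ ω ∂P, ∑ p ∈ S, c p * Y p ω ≠ d := by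
  classical
  have h1 := hind.comp (fun p x => c p * x) (fun p => by fun_prop)
  have h2 := h1.indepFun_finsetSum_of_notMem (fun p => ((hY p).const_mul (c p)))
    (Finset.notMem_erase p₀ S)
  -- The relation solved for `Y p₀`: its other side depends only on the remaining variables.
  have h3 : IndepFun (fun ω => (d - ∑ p ∈ S.erase p₀, c p * Y p ω) / c p₀) (Y p₀) P := by
    have h4 := h2.comp (φ := fun x => (d - x) / c p₀) (ψ := fun x => x / c p₀)
      (by fun_prop) (by fun_prop)
    convert h4 using 1
    · ext ω; simp [Finset.sum_apply]
    · ext ω; simp [hc]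
  have := hatom p₀
  filter_upwards [ae_ne_of_indepFun (by fun_prop) (hY p₀) h3] with ω hω h
  apply hω
  rw [← Finset.add_sum_erase S _ hp₀] at h
  rw [← h]
  field_simp
  ring

/-- Limit of the sample mean of `x` along sample sizes that are eventually `n` (`some n`) or tend to
infinity (`none`); in the latter case it is the given value `a`. -/
noncomputable def limitMean (a : ℝ) (x : ℕ → ℝ) : Option ℕ → ℝ
  | none => a
  | some n => sampleMean x n

/-- An affine form over a common index range, so that pairs frozen at different sizes can be
combined in one linear relation. -/
lemma limitMean_eq_sum (a : ℝ) (x : ℕ → ℝ) {o : Option ℕ} {R : ℕ} (hR : ∀ n ∈ o, n ≤ R) :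
    limitMean a x o = o.elim a (fun _ => 0)
      + ∑ r ∈ Finset.range R, o.elim 0 (fun n => if r < n then 1 / (n : ℝ) else 0) * x r := by
  cases o with
  | none => simp [limitMean]
  | some n =>
    have hn : n ≤ R := hR n rfl
    simp only [limitMean, Option.elim, zero_add, sampleMean, ite_mul, zero_mul]
    rw [← Finset.sum_filter, Finset.mul_sum]
    refine Finset.sum_congr ?_ fun _ _ => rfl
    ext r
    simp only [Finset.mem_range, Finset.mem_filter]
    omega

variable {K D : ℕ} {X : Fin K → Fin D → ℕ → Ω → ℝ}

lemma ae_limit_perf_ne (hX : ∀ i j r, Measurable (X i j r))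
    (hind : iIndepFun (fun p : Fin K × Fin D × ℕ => X p.1 p.2.1 p.2.2) P)
    (hatom : ∀ i j r, NullSingletonClass (P.map (X i j r)))
    {μ : Fin K → Fin D → ℝ} {wc : Fin D → ℝ} (hwc : ∀ j, 0 < wc j)
    (hdist : Function.Injective (perf μ wc))
    (o : Fin K → Fin D → Option ℕ) (ho : ∀ i j, ∀ n ∈ o i j, 1 ≤ n) {i k : Fin K} (hik : i ≠ k) :
    ∀ᵐ ω ∂P, ∑ j, wc j * limitMean (μ i j) (fun r => X i j r ω) (o i j)
      ≠ ∑ j, wc j * limitMean (μ k j) (fun r => X k j r ω) (o k j) := by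
  classical
  by_cases hnone : (∀ j, o i j = none) ∧ (∀ j, o k j = none)
  · refine ae_of_all _ fun ω => ?_
    simp only [hnone.1, hnone.2, limitMean]
    exact fun h => hik (hdist h)
  let R : ℕ := ∑ i, ∑ j, (o i j).getD 0
  have hR : ∀ i j, ∀ n ∈ o i j, n ≤ R := fun i j n hn => by
    have h1 : n = (o i j).getD 0 := by rw [Option.mem_def.1 hn]; rfl
    rw [h1]
    exact (Finset.single_le_sum (f := fun j => (o i j).getD 0) (fun _ _ => Nat.zero_le _)
      (Finset.mem_univ j)).trans (Finset.single_le_sum (f := fun i => ∑ j, (o i j).getD 0)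
      (fun _ _ => Nat.zero_le _) (Finset.mem_univ i))
  -- Signs that turn the difference of the two designs into one sum over all outputs.
  let e : Fin K → ℝ := fun a => if a = i then 1 else if a = k then -1 else 0
  have he : ∀ g : Fin K → ℝ, ∑ a, e a * g a = g i - g k := fun g => by
    have h : ∀ a, e a * g a = (if a = i then g a else 0) - (if a = k then g a else 0) := fun a => by
      by_cases h1 : a = i
      · have h2 : a ≠ k := fun h => hik (h1.symm.trans h)
        simp [e, h1, hik]
      · by_cases h2 : a = k
        · subst h2; simp [e, h1]
        · simp [e, h1, h2]
    simp [h]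
  let q : Fin K → Fin D → ℕ → ℝ := fun a j r =>
    (o a j).elim 0 (fun n => if r < n then 1 / (n : ℝ) else 0)
  let c : Fin K × Fin D × ℕ → ℝ := fun p => e p.1 * (wc p.2.1 * q p.1 p.2.1 p.2.2)
  let S : Finset (Fin K × Fin D × ℕ) := Finset.univ ×ˢ (Finset.univ ×ˢ Finset.range R)
  let d : Fin K → ℝ := fun a => ∑ j, wc j * (o a j).elim (μ a j) (fun _ => 0)
  have hsum : ∀ ω a, ∑ j, wc j * limitMean (μ a j) (fun r => X a j r ω) (o a j)
      = d a + ∑ j, ∑ r ∈ Finset.range R, wc j * q a j r * X a j r ω := fun ω a => by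
    rw [← Finset.sum_add_distrib]
    refine Finset.sum_congr rfl fun j _ => ?_
    rw [limitMean_eq_sum _ _ (hR a j), mul_add, Finset.mul_sum]
    congr 1
    refine Finset.sum_congr rfl fun r _ => ?_
    simp only [q]
    ring
  obtain ⟨a, j, hea, n, hn⟩ : ∃ a j, e a ≠ 0 ∧ ∃ n, o a j = some n := by
    rw [not_and_or, not_forall, not_forall] at hnone
    rcases hnone with ⟨j, hj⟩ | ⟨j, hj⟩
    · exact ⟨i, j, by simp [e], Option.ne_none_iff_exists'.1 hj⟩
    · exact ⟨k, j, by simp [e, hik.symm], Option.ne_none_iff_exists'.1 hj⟩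
  have hn1 : 1 ≤ n := ho a j n hn
  -- The first output of a frozen pair always enters its mean, with coefficient `1 / n`.
  have hp₀ : (a, j, 0) ∈ S := by
    have := hR a j n hn
    simp only [S, Finset.mem_product, Finset.mem_univ, Finset.mem_range, true_and]
    omega
  have hcp : c (a, j, 0) ≠ 0 := by
    have h0 : 0 < n := hn1
    have : (n : ℝ) ≠ 0 := by positivity
    simp [c, q, hn, h0, hea, (hwc j).ne', this]
  have hmain := ae_sum_mul_ne (fun p => hX p.1 p.2.1 p.2.2) hind (fun p => hatom p.1 p.2.1 p.2.2)
    S c hp₀ hcp (d k - d i)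
  filter_upwards [hmain] with ω hω h
  apply hω
  have h2 : ∑ p ∈ S, c p * X p.1 p.2.1 p.2.2 ω
      = ∑ a, e a * ∑ j, ∑ r ∈ Finset.range R, wc j * q a j r * X a j r ω := by
    simp only [S, Finset.sum_product]
    refine Finset.sum_congr rfl fun a _ => ?_
    rw [Finset.mul_sum]
    refine Finset.sum_congr rfl fun j _ => ?_
    rw [Finset.mul_sum]
    refine Finset.sum_congr rfl fun r _ => ?_
    simp only [c]
    ring
  rw [h2, he]
  rw [hsum, hsum] at h
  linarith

end SampleStatistics

end IUOCBA

/-! ### Deterministic tools: stages, monotone sizes, barriers. -/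

namespace IUOCBA

lemma tendsto_stage {n : ℕ → ℕ} (hn : Tendsto (cumul n) atTop atTop) :
    Tendsto (fun l => stage n (l + 1)) atTop atTop := by
  refine tendsto_atTop.2 fun t => ?_
  filter_upwards [eventually_ge_atTop (cumul n t)] with l hl
  obtain ⟨t₀, ht₀⟩ := eventually_atTop.1 (hn.eventually_ge_atTop (l + 1))
  -- Needed because `sSup` of an unbounded set of naturals is 0.
  have hbdd : BddAbove {t | 1 ≤ t ∧ cumul n (t - 1) < l + 1} := by
    refine ⟨t₀, fun s hs => ?_⟩
    by_contra hlt
    have := ht₀ (s - 1) (by omega)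
    have := hs.2
    omega
  have hmem : t + 1 ∈ {t | 1 ≤ t ∧ cumul n (t - 1) < l + 1} :=
    ⟨by omega, by simpa using Nat.lt_succ_of_le hl⟩
  exact (Nat.le_succ t).trans (le_csSup hbdd hmem)

/-- Behaviour of a sample size in the long run: it is eventually `k` (`some k`), or it tends to
infinity (`none`). -/
def SizeLimit (u : ℕ → ℕ) : Option ℕ → Prop
  | none => Tendsto u atTop atTop
  | some k => ∀ᶠ l in atTop, u l = k

lemma exists_sizeLimit {u : ℕ → ℕ} (hu : Monotone u) : ∃ o, SizeLimit u o := by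
  rcases tendsto_atTop_of_monotone hu with h | ⟨k, hk⟩
  · exact ⟨none, h⟩
  · refine ⟨some k, ?_⟩
    rw [nhds_discrete, tendsto_pure] at hk
    exact hk

lemma SizeLimit.tendsto_comp {u : ℕ → ℕ} {o : Option ℕ} (h : SizeLimit u o) {g : ℕ → ℝ} {a : ℝ}
    (hg : Tendsto g atTop (𝓝 a)) : Tendsto (fun l => g (u l)) atTop (𝓝 (o.elim a g)) := by
  cases o with
  | none => exact hg.comp h
  | some k =>
    refine tendsto_const_nhds.congr' ?_
    filter_upwards [h] with l hl
    simp [hl]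

/-- The maximizer of `v l` is eventually the strict maximizer of the limit of `v`. -/
lemma eventually_eq_of_isMax {ι : Type*} [Finite ι] {v : ℕ → ι → ℝ} {a : ι → ℝ} {c : ι}
    (hv : ∀ i, Tendsto (fun l => v l i) atTop (𝓝 (a i))) (hc : ∀ i, i ≠ c → a i < a c)
    {s : ℕ → ι} (hs : ∀ᶠ l in atTop, ∀ i, v l i ≤ v l (s l)) : ∀ᶠ l in atTop, s l = c := by
  have h : ∀ i, ∀ᶠ l in atTop, i ≠ c → v l i < v l c := fun i => by
    by_cases hi : i = c
    · exact Eventually.of_forall fun l h => absurd hi h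
    · filter_upwards [(hv i).eventually_lt (hv c) (hc i hi)] with l hl _ using hl
  filter_upwards [hs, eventually_all.2 h] with l h1 h2
  by_contra hne
  exact absurd (h1 c) (not_le.2 (h2 _ hne))

/-- If every step of `a` is nonincreasing or lands below the nondecreasing barrier `B`, then `a`
stays below its initial value or the barrier. -/
lemma le_max_of_barrier {a B : ℕ → ℝ} (hB : Monotone B) {l₀ : ℕ}
    (h : ∀ l, l₀ ≤ l → a (l + 1) ≤ a l ∨ a (l + 1) ≤ B (l + 1)) :
    ∀ l, l₀ ≤ l → a l ≤ max (a l₀) (B l) := by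
  intro l hl
  induction l, hl using Nat.le_induction with
  | base => exact le_max_left _ _
  | succ l hl ih =>
    rcases h l hl with h1 | h1
    · exact h1.trans (ih.trans (max_le_max_left _ (hB (Nat.le_succ l))))
    · exact h1.trans (le_max_right _ _)

/-- With `ε / 2` in the drift condition, `g` stays below its value at `l₀` or the barrier `ε / 2 * S
^ 2 + c * S`; the other half of `ε` absorbs the linear overshoot. -/
lemma eventually_le_mul_sq_of_drift {g S : ℕ → ℝ} {c : ℝ} (hc : 0 ≤ c) (hS0 : ∀ l, 0 ≤ S l)
    (hSm : Monotone S) (hS : Tendsto S atTop atTop) (hstep : ∀ l, g (l + 1) ≤ g l + c * S (l + 1))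
    (hdrift : ∀ ε > 0, ∀ᶠ l in atTop, ε * S l ^ 2 < g l → g (l + 1) ≤ g l) {ε : ℝ} (hε : 0 < ε) :
    ∀ᶠ l in atTop, g l ≤ ε * S l ^ 2 := by
  obtain ⟨l₀, hl₀⟩ := eventually_atTop.1 (hdrift (ε / 2) (half_pos hε))
  have hB : Monotone fun l => ε / 2 * S l ^ 2 + c * S l := fun a b hab => by
    have h1 := hSm hab
    have h2 := hS0 a
    show ε / 2 * S a ^ 2 + c * S a ≤ ε / 2 * S b ^ 2 + c * S b
    gcongr
  have hbar := le_max_of_barrier (a := g) hB (l₀ := l₀) fun l hl => by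
    by_cases hlt : ε / 2 * S l ^ 2 < g l
    · exact Or.inl (hl₀ l hl hlt)
    · refine Or.inr ((hstep l).trans ?_)
      have h1 := hSm (Nat.le_succ l)
      have h2 := hS0 l
      have h3 : ε / 2 * S l ^ 2 ≤ ε / 2 * S (l + 1) ^ 2 := by gcongr
      show _ ≤ ε / 2 * S (l + 1) ^ 2 + c * S (l + 1)
      linarith
  filter_upwards [eventually_ge_atTop l₀, hS.eventually_ge_atTop (2 * c / ε),
    hS.eventually_ge_atTop 1, hS.eventually_ge_atTop (g l₀ / ε)] with l h0 h1 h2 h3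
  refine (hbar l h0).trans (max_le ?_ ?_)
  · rw [div_le_iff₀ hε] at h3
    have := mul_le_mul_of_nonneg_right h2 (mul_nonneg hε.le (hS0 l))
    linarith
  · rw [div_le_iff₀ hε] at h1
    nlinarith

/-! ### Regular runs: infinite sampling and consistency. -/

namespace Trajectory

variable {K D : ℕ} {Z : Type*}

/-- A run of IU-OCBA-balance on data along which the weight estimates, sample means and sample
standard deviations converge to the true values, no sample standard deviation vanishes, and no two
designs have the same limiting estimate, whatever pairs are sampled only finitely often. -/
structure IsRegularRun (T : Trajectory K D) (f : Fin D → Z → ℝ≥0) (n₀ : ℕ) (n m : ℕ → ℕ)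
    (x : ℕ → Z) (X : Fin K → Fin D → ℕ → ℝ) (wc : Fin D → ℝ) (μ σ : Fin K → Fin D → ℝ)
    (b : Fin K) : Prop where
  run : T.IsBalanceRun f n₀ n m x X
  two_le_init : 2 ≤ n₀
  nonempty : Nonempty (Fin D)
  budget : Tendsto (cumul n) atTop atTop
  weight_pos : ∀ j, 0 < wc j
  sigma_pos : ∀ i j, 0 < σ i j
  best : ∀ i, i ≠ b → perf μ wc i < perf μ wc b
  weight_tendsto : Tendsto T.w atTop (𝓝 wc)
  mean_tendsto : ∀ i j, Tendsto (sampleMean (X i j)) atTop (𝓝 (μ i j))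
  sd_tendsto : ∀ i j, Tendsto (sampleSD (X i j)) atTop (𝓝 (σ i j))
  sd_pos : ∀ i j N, 2 ≤ N → 0 < sampleSD (X i j) N
  limit_ne : ∀ o : Fin K → Fin D → Option ℕ, (∀ i j, ∀ k ∈ o i j, 1 ≤ k) → ∀ i k, i ≠ k →
    ∑ j, wc j * limitMean (μ i j) (X i j) (o i j) ≠ ∑ j, wc j * limitMean (μ k j) (X k j) (o k j)

namespace IsRegularRun

variable {T : Trajectory K D} {f : Fin D → Z → ℝ≥0} {n₀ : ℕ} {n m : ℕ → ℕ} {x : ℕ → Z}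
  {X : Fin K → Fin D → ℕ → ℝ} {wc : Fin D → ℝ} {μ σ : Fin K → Fin D → ℝ} {b : Fin K}

lemma monotone_N (h : T.IsRegularRun f n₀ n m x X wc μ σ b) (i : Fin K) (j : Fin D) :
    Monotone fun l => T.N l i j :=
  monotone_nat_of_le_succ fun l => by
    rw [h.run.step]
    split_ifs <;> omega

lemma two_le_N (h : T.IsRegularRun f n₀ n m x X wc μ σ b) (l : ℕ) (i : Fin K) (j : Fin D) :
    2 ≤ T.N l i j := by
  have h1 := h.monotone_N i j (Nat.zero_le l)
  simp only [h.run.init] at h1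
  exact h.two_le_init.trans h1

lemma N_succ_le (h : T.IsRegularRun f n₀ n m x X wc μ σ b) (l : ℕ) (i : Fin K) (j : Fin D) :
    T.N (l + 1) i j ≤ T.N l i j + 1 := by
  rw [h.run.step]
  split_ifs <;> omega

lemma N_succ_of_ne (h : T.IsRegularRun f n₀ n m x X wc μ σ b) {l : ℕ} {i : Fin K} {j : Fin D}
    (hne : ¬ (i = T.I l ∧ j = T.J l)) : T.N (l + 1) i j = T.N l i j := by
  rw [h.run.step, if_neg hne]

lemma total_succ (h : T.IsRegularRun f n₀ n m x X wc μ σ b) (l : ℕ) :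
    T.total (l + 1) = T.total l + 1 := by
  have h1 : ∀ i j, T.N (l + 1) i j = T.N l i j + if i = T.I l ∧ j = T.J l then 1 else 0 :=
    fun i j => by rw [h.run.step]; split_ifs <;> rfl
  unfold total
  simp only [h1, Finset.sum_add_distrib, ite_and]
  simp

lemma le_total (h : T.IsRegularRun f n₀ n m x X wc μ σ b) (l : ℕ) : l ≤ T.total l := by
  induction l with
  | zero => exact Nat.zero_le _
  | succ l ih => rw [h.total_succ]; omega

lemma N_le_total (l : ℕ) (i : Fin K) (j : Fin D) : T.N l i j ≤ T.total l :=
  (Finset.single_le_sum (f := fun j => T.N l i j) (fun _ _ => Nat.zero_le _)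
    (Finset.mem_univ j)).trans (Finset.single_le_sum (f := fun i => ∑ j, T.N l i j)
      (fun _ _ => Nat.zero_le _) (Finset.mem_univ i))

lemma total_pos (h : T.IsRegularRun f n₀ n m x X wc μ σ b) (l : ℕ) : (0 : ℝ) < T.total l := by
  obtain ⟨j⟩ := h.nonempty
  have h1 := h.two_le_N l b j
  have h2 := N_le_total (T := T) l b j
  exact Nat.cast_pos.2 (by omega)

lemma tendsto_total (h : T.IsRegularRun f n₀ n m x X wc μ σ b) :
    Tendsto (fun l => (T.total l : ℝ)) atTop atTop :=
  tendsto_natCast_atTop_atTop.comp (tendsto_atTop_mono h.le_total tendsto_id)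

lemma monotone_total (h : T.IsRegularRun f n₀ n m x X wc μ σ b) :
    Monotone fun l => (T.total l : ℝ) :=
  monotone_nat_of_le_succ fun l => by rw [h.total_succ]; push_cast; linarith

lemma sdPair_pos (h : T.IsRegularRun f n₀ n m x X wc μ σ b) (l : ℕ) (i : Fin K) (j : Fin D) :
    0 < T.sdPair X l i j :=
  h.sd_pos i j _ (h.two_le_N l i j)

lemma tendsto_wcur (h : T.IsRegularRun f n₀ n m x X wc μ σ b) (j : Fin D) :
    Tendsto (fun l => T.wcur n l j) atTop (𝓝 (wc j)) :=
  ((tendsto_pi_nhds.1 h.weight_tendsto) j).comp (tendsto_stage h.budget)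

lemma eventually_wcur_pos (h : T.IsRegularRun f n₀ n m x X wc μ σ b) :
    ∀ᶠ l in atTop, ∀ j, 0 < T.wcur n l j :=
  eventually_all.2 fun j => (h.tendsto_wcur j).eventually_const_lt (h.weight_pos j)

lemma exists_limits (h : T.IsRegularRun f n₀ n m x X wc μ σ b) :
    ∃ o : Fin K → Fin D → Option ℕ, ∀ i j, SizeLimit (fun l => T.N l i j) (o i j) := by
  choose o ho using fun i j => exists_sizeLimit (h.monotone_N i j)
  exact ⟨o, ho⟩

lemma two_le_of_sizeLimit (h : T.IsRegularRun f n₀ n m x X wc μ σ b) {i : Fin K} {j : Fin D}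
    {k : ℕ} (ho : SizeLimit (fun l => T.N l i j) (some k)) : 2 ≤ k := by
  obtain ⟨l, hl⟩ := (show ∀ᶠ l in atTop, T.N l i j = k from ho).exists
  exact hl ▸ h.two_le_N l i j

lemma tendsto_muHat (h : T.IsRegularRun f n₀ n m x X wc μ σ b) {o : Fin K → Fin D → Option ℕ}
    (ho : ∀ i j, SizeLimit (fun l => T.N l i j) (o i j)) (i : Fin K) :
    Tendsto (fun l => T.muHat n X l i) atTop
      (𝓝 (∑ j, wc j * limitMean (μ i j) (X i j) (o i j))) := by
  refine tendsto_finsetSum _ fun j _ => (h.tendsto_wcur j).mul ?_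
  have h1 := (ho i j).tendsto_comp (h.mean_tendsto i j)
  cases hoij : o i j <;> rw [hoij] at h1 <;> exact h1

lemma exists_tendsto_sdPair (h : T.IsRegularRun f n₀ n m x X wc μ σ b) {i : Fin K} {j : Fin D}
    {o : Option ℕ} (ho : SizeLimit (fun l => T.N l i j) o) :
    ∃ s, 0 < s ∧ Tendsto (fun l => T.sdPair X l i j) atTop (𝓝 s) := by
  refine ⟨_, ?_, ho.tendsto_comp (h.sd_tendsto i j)⟩
  cases o with
  | none => exact h.sigma_pos i j
  | some k => exact h.sd_pos i j k (h.two_le_of_sizeLimit ho)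

/-- A pair that is sampled only finitely often has a bounded sample size. -/
lemma not_tendsto_of_eventually_not_sampled (h : T.IsRegularRun f n₀ n m x X wc μ σ b)
    {i : Fin K} {j : Fin D} (hns : ∀ᶠ l in atTop, ¬ (i = T.I l ∧ j = T.J l)) :
    ¬ Tendsto (fun l => T.N l i j) atTop atTop := by
  intro ht
  obtain ⟨l₀, hl₀⟩ := eventually_atTop.1 hns
  have hconst : ∀ l, l₀ ≤ l → T.N l i j = T.N l₀ i j := fun l hl => by
    induction l, hl using Nat.le_induction with
    | base => rfl
    | succ l hl ih => rw [h.N_succ_of_ne (hl₀ l hl), ih]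
  obtain ⟨l, h1, h2⟩ := ((ht.eventually_gt_atTop (T.N l₀ i j)).and (eventually_ge_atTop l₀)).exists
  rw [hconst l h2] at h1
  exact lt_irrefl _ h1

lemma inputStat_eq (h : T.IsRegularRun f n₀ n m x X wc μ σ b) {l : ℕ} {j : Fin D}
    (hw : 0 < T.wcur n l j) (i : Fin K) : T.inputStat n X l i j
      = ENNReal.ofReal ((T.N l i j : ℝ) / (T.sdPair X l i j * T.wcur n l j)) := by
  rw [ENNReal.ofReal_div_of_pos (mul_pos (h.sdPair_pos l i j) hw), ENNReal.ofReal_natCast]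
  rfl

lemma eventually_div_le_of_sampled (h : T.IsRegularRun f n₀ n m x X wc μ σ b) (i : Fin K)
    (j k : Fin D) : ∀ᶠ l in atTop, i = T.I l ∧ j = T.J l →
      (T.N l i j : ℝ) / (T.sdPair X l i j * T.wcur n l j)
        ≤ (T.N l i k : ℝ) / (T.sdPair X l i k * T.wcur n l k) := by
  filter_upwards [h.eventually_wcur_pos] with l hw hs
  have h1 := h.run.input_min l k
  rw [← hs.1, ← hs.2, h.inputStat_eq (hw j), h.inputStat_eq (hw k)] at h1
  refine (ENNReal.ofReal_le_ofReal_iff ?_).1 h1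
  exact div_nonneg (Nat.cast_nonneg _) (mul_pos (h.sdPair_pos l i k) (hw k)).le

lemma tendsto_div_atTop_of_none {g : ℕ → ℝ} {s : ℝ} (hs : 0 < s) (hg : Tendsto g atTop (𝓝 s))
    {u : ℕ → ℕ} (hu : Tendsto u atTop atTop) : Tendsto (fun l => (u l : ℝ) / g l) atTop atTop :=
  (tendsto_natCast_atTop_atTop.comp hu).atTop_mul_pos (inv_pos.2 hs) (hg.inv₀ hs.ne')

lemma exists_tendsto_div_of_some {g : ℕ → ℝ} {s : ℝ} (hs : 0 < s) (hg : Tendsto g atTop (𝓝 s))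
    {u : ℕ → ℕ} {k : ℕ} (hu : SizeLimit u (some k)) :
    ∃ a, Tendsto (fun l => (u l : ℝ) / g l) atTop (𝓝 a) := by
  refine ⟨k / s, (Tendsto.div tendsto_const_nhds hg hs.ne').congr' ?_⟩
  filter_upwards [show ∀ᶠ l in atTop, u l = k from hu] with l hl
  rw [hl, Pi.div_apply]

/-- If one input component of a design is sampled infinitely often, then all are. -/
lemma eq_none_of_eq_none (h : T.IsRegularRun f n₀ n m x X wc μ σ b)
    {o : Fin K → Fin D → Option ℕ} (ho : ∀ i j, SizeLimit (fun l => T.N l i j) (o i j))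
    {i : Fin K} {j : Fin D} (hj : o i j = none) (k : Fin D) : o i k = none := by
  by_contra hk
  obtain ⟨a, ha⟩ := Option.ne_none_iff_exists'.1 hk
  have hoj := ho i j
  have hok := ho i k
  obtain ⟨s, hs, hst⟩ := h.exists_tendsto_sdPair hoj
  obtain ⟨r, hr, hrt⟩ := h.exists_tendsto_sdPair hok
  rw [hj] at hoj
  rw [ha] at hok
  have h1 := tendsto_div_atTop_of_none (mul_pos hs (h.weight_pos j))
    (hst.mul (h.tendsto_wcur j)) hoj
  obtain ⟨c, h2⟩ := exists_tendsto_div_of_some (mul_pos hr (h.weight_pos k))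
    (hrt.mul (h.tendsto_wcur k)) hok
  -- The quotient of `j` outgrows the bounded quotient of `k`, so `j` would eventually never be the
  -- minimizer.
  refine h.not_tendsto_of_eventually_not_sampled (i := i) (j := j) ?_ hoj
  filter_upwards [h1.eventually_gt_atTop (c + 1), h2.eventually_lt_const (lt_add_one c),
    h.eventually_div_le_of_sampled i j k] with l h3 h4 h5 h6
  have := h5 h6
  linarith

lemma exists_eq_none (h : T.IsRegularRun f n₀ n m x X wc μ σ b)
    {o : Fin K → Fin D → Option ℕ} (ho : ∀ i j, SizeLimit (fun l => T.N l i j) (o i j)) :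
    ∃ i j, o i j = none := by
  by_contra! hcon
  choose k hk using fun i j => Option.ne_none_iff_exists'.1 (hcon i j)
  have h1 : ∀ᶠ l in atTop, ∀ i j, T.N l i j = k i j :=
    eventually_all.2 fun i => eventually_all.2 fun j => by
      have := ho i j
      rw [hk] at this
      exact this
  obtain ⟨l, h2, h3⟩ := (h1.and (eventually_gt_atTop (∑ i, ∑ j, k i j))).exists
  have h4 := h.le_total l
  have h5 : T.total l = ∑ i, ∑ j, k i j := by
    unfold total
    simp only [h2]
  omega

/-- Contribution of a pair to the limit of the denominators of the local balance statistics. -/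
lemma tendsto_variance_term (h : T.IsRegularRun f n₀ n m x X wc μ σ b) {i : Fin K} {j : Fin D}
    {o : Option ℕ} (ho : SizeLimit (fun l => T.N l i j) o) :
    ∃ v, 0 ≤ v ∧ (o = none → v = 0) ∧ (o ≠ none → 0 < v) ∧
      Tendsto (fun l => T.sdPair X l i j ^ 2 * T.wcur n l j ^ 2 / (T.N l i j : ℝ)) atTop (𝓝 v) := by
  obtain ⟨s, hs, hst⟩ := h.exists_tendsto_sdPair ho
  have h1 := (hst.pow 2).mul ((h.tendsto_wcur j).pow 2)
  have hp := mul_pos (pow_pos hs 2) (pow_pos (h.weight_pos j) 2)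
  cases o with
  | none =>
    exact ⟨0, le_rfl, fun _ => rfl, fun h => absurd rfl h,
      h1.div_atTop (tendsto_natCast_atTop_atTop.comp ho)⟩
  | some k =>
    have hk := h.two_le_of_sizeLimit ho
    have hk0 : (0 : ℝ) < k := Nat.cast_pos.2 (by omega)
    refine ⟨s ^ 2 * wc j ^ 2 / k, (div_pos hp hk0).le, nofun, fun _ => div_pos hp hk0,
      (h1.div_const (k : ℝ)).congr' ?_⟩
    filter_upwards [show ∀ᶠ l in atTop, T.N l i j = k from ho] with l hl
    rw [hl]

/-- Every pair is sampled infinitely often. -/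
theorem tendsto_N (h : T.IsRegularRun f n₀ n m x X wc μ σ b) (i : Fin K) (j : Fin D) :
    Tendsto (fun l => T.N l i j) atTop atTop := by
  obtain ⟨o, ho⟩ := h.exists_limits
  suffices hall : ∀ i j, o i j = none by
    have := ho i j
    rwa [hall] at this
  clear i j
  obtain ⟨j₀⟩ := h.nonempty
  let a : Fin K → ℝ := fun i => ∑ j, wc j * limitMean (μ i j) (X i j) (o i j)
  have ha : ∀ i k, i ≠ k → a i ≠ a k := h.limit_ne o fun i j k hk => by
    have := ho i j
    rw [Option.mem_def.1 hk] at this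
    have := h.two_le_of_sizeLimit this
    omega
  have hmu : ∀ i, Tendsto (fun l => T.muHat n X l i) atTop (𝓝 (a i)) := h.tendsto_muHat ho
  have : Nonempty (Fin K) := ⟨b⟩
  -- At this stage `c` need not be `b`, as frozen pairs may distort the limits `a`.
  obtain ⟨c, hc⟩ := Finite.exists_max a
  have hc' : ∀ i, i ≠ c → a i < a c := fun i hi => lt_of_le_of_ne (hc i) (ha i c hi)
  have hbhat : ∀ᶠ l in atTop, T.bhat l = c :=
    eventually_eq_of_isMax hmu hc' (Eventually.of_forall h.run.bhat_max)
  have hsq_none : ∀ {i j}, o i j = none →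
      Tendsto (fun l => ((T.N l i j : ℝ) / T.sdPair X l i j) ^ 2) atTop atTop := fun {i j} hij => by
    obtain ⟨s, hs, hst⟩ := h.exists_tendsto_sdPair (ho i j)
    have := ho i j
    rw [hij] at this
    exact (tendsto_pow_atTop two_ne_zero).comp (tendsto_div_atTop_of_none hs hst this)
  have hsq_some : ∀ {i j}, o i j ≠ none → ∃ v,
      Tendsto (fun l => ((T.N l i j : ℝ) / T.sdPair X l i j) ^ 2) atTop (𝓝 v) := fun {i j} hij => by
    obtain ⟨s, hs, hst⟩ := h.exists_tendsto_sdPair (ho i j)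
    obtain ⟨k, hk⟩ := Option.ne_none_iff_exists'.1 hij
    have := ho i j
    rw [hk] at this
    obtain ⟨v, hv⟩ := exists_tendsto_div_of_some hs hst this
    exact ⟨v ^ 2, hv.pow 2⟩
  have hunb : ∀ {i j}, o i j = none → ¬ ∀ᶠ l in atTop, ¬ (i = T.I l ∧ j = T.J l) :=
    fun {i j} hij hns => by
      have := ho i j
      rw [hij] at this
      exact h.not_tendsto_of_eventually_not_sampled hns this
  -- Were `c` frozen, some other design would drive a gap to −∞, and the test would then select only
  -- `c`.
  have hcnone : ∀ j, o c j = none := by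
    obtain ⟨i, j, hij⟩ := h.exists_eq_none ho
    by_contra hcon
    have hcj : o c j ≠ none := fun hcj => hcon (h.eq_none_of_eq_none ho hcj)
    have hic : i ≠ c := fun hic => hcj (hic ▸ hij)
    obtain ⟨v, hv⟩ := hsq_some hcj
    refine hunb hij ?_
    filter_upwards [hbhat, hv.eventually_lt_const (lt_add_one v),
      (hsq_none hij).eventually_gt_atTop (v + 1)] with l hb h1 h2 hs
    have hgap : T.totalGap X l j < 0 := by
      unfold totalGap
      rw [hb]
      have := Finset.single_le_sum (f := fun i => ((T.N l i j : ℝ) / T.sdPair X l i j) ^ 2)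
        (fun _ _ => sq_nonneg _) (Finset.mem_erase.2 ⟨hic, Finset.mem_univ i⟩)
      linarith
    have hI := h.run.best l ((h.run.jstar_min l j).trans_lt hgap)
    exact hic (hs.1.trans (hI.trans hb))
  -- Were all others frozen, every gap would eventually be nonnegative and `c` would no longer be
  -- simulated.
  obtain ⟨i, hic, hi⟩ : ∃ i, i ≠ c ∧ ∀ j, o i j = none := by
    by_contra! hcon
    have hsome : ∀ i, i ≠ c → ∀ j, o i j ≠ none := fun i hi j hij => by
      obtain ⟨k, hk⟩ := hcon i hi
      exact hk (h.eq_none_of_eq_none ho hij k)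
    refine hunb (hcnone j₀) ?_
    have hgap : ∀ j, ∀ᶠ l in atTop, 0 ≤ T.totalGap X l j := fun j => by
      have hsum : ∃ v, Tendsto (fun l => ∑ i ∈ Finset.univ.erase c,
          ((T.N l i j : ℝ) / T.sdPair X l i j) ^ 2) atTop (𝓝 v) := by
        choose! v hv using fun i (hi : i ≠ c) => hsq_some (hsome i hi j)
        exact ⟨_, tendsto_finsetSum _ fun i hi => hv i (Finset.ne_of_mem_erase hi)⟩
      obtain ⟨v, hv⟩ := hsum
      filter_upwards [hbhat, hv.eventually_lt_const (lt_add_one v),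
        (hsq_none (hcnone j)).eventually_gt_atTop (v + 1)] with l hb h1 h2
      unfold totalGap
      rw [hb]
      linarith
    filter_upwards [hbhat, eventually_all.2 hgap] with l hb h1 hs
    exact (h.run.nonbest l (not_lt.2 (h1 _))).1 (hs.1.symm.trans hb.symm)
  intro k
  by_contra hcon
  have hk : ∀ j, o k j ≠ none := fun j hj => hcon (h.eq_none_of_eq_none ho hj)
  have hkc : k ≠ c := fun hkc => hk j₀ (hkc ▸ hcnone j₀)
  choose v hv0 hvn hvs hv using fun i j => h.tendsto_variance_term (ho i j)
  have hden : ∀ i, Tendsto (fun l =>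
      ∑ j, T.sdPair X l (T.bhat l) j ^ 2 * T.wcur n l j ^ 2 / (T.N l (T.bhat l) j : ℝ)
        + ∑ j, T.sdPair X l i j ^ 2 * T.wcur n l j ^ 2 / (T.N l i j : ℝ)) atTop
      (𝓝 (∑ j, v c j + ∑ j, v i j)) := fun i => by
    have h1 := (tendsto_finsetSum Finset.univ fun j _ => hv c j).add
      (tendsto_finsetSum Finset.univ fun j _ => hv i j)
    refine h1.congr' ?_
    filter_upwards [hbhat] with l hb
    rw [hb]
  have hnum : ∀ i, Tendsto (fun l => (T.muHat n X l (T.bhat l) - T.muHat n X l i) ^ 2) atTop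
      (𝓝 ((a c - a i) ^ 2)) := fun i => by
    refine (((hmu c).sub (hmu i)).pow 2).congr' ?_
    filter_upwards [hbhat] with l hb
    rw [hb]
  have hvk : 0 < ∑ j, v c j + ∑ j, v k j :=
    add_pos_of_nonneg_of_pos (Finset.sum_nonneg fun j _ => hv0 c j)
      (Finset.sum_pos (fun j _ => hvs k j (hk j)) ⟨j₀, Finset.mem_univ _⟩)
  have hvi : ∑ j, v c j + ∑ j, v i j = 0 := by
    rw [Finset.sum_eq_zero fun j _ => hvn c j (hcnone j),
      Finset.sum_eq_zero fun j _ => hvn i j (hi j), add_zero]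
  have hlk : Tendsto (fun l => T.localStat n X l k) atTop
      (𝓝 ((a c - a k) ^ 2 / (∑ j, v c j + ∑ j, v k j))) := (hnum k).div (hden k) hvk.ne'
  -- The denominator tends to 0 while the numerator has a positive limit because there are no ties.
  -- The statistic of the frozen `k` stays bounded, so `i` could never be preferred to it.
  have hli : Tendsto (fun l => T.localStat n X l i) atTop atTop := by
    have h1 := hden i
    rw [hvi] at h1
    have h2 := (tendsto_nhdsWithin_iff.2 ⟨h1, by
      filter_upwards [h.eventually_wcur_pos] with l hw
      have hpos : ∀ i j, 0 < T.sdPair X l i j ^ 2 * T.wcur n l j ^ 2 / (T.N l i j : ℝ) :=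
        fun i j => by
          have h3 := h.two_le_N l i j
          have h4 : (0 : ℝ) < T.N l i j := Nat.cast_pos.2 (by omega)
          have h5 := h.sdPair_pos l i j
          have h6 := hw j
          positivity
      exact add_pos_of_nonneg_of_pos (Finset.sum_nonneg fun j _ => (hpos _ j).le)
        (Finset.sum_pos (fun j _ => hpos i j) ⟨j₀, Finset.mem_univ _⟩)⟩ :
      Tendsto _ atTop (𝓝[>] (0 : ℝ)))
    have h3 := (tendsto_inv_nhdsGT_zero.comp h2)
    have h4 : 0 < (a c - a i) ^ 2 := pow_pos (sub_pos.2 (hc' i hic)) 2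
    exact (hnum i).pos_mul_atTop h4 h3
  refine hunb (hi j₀) ?_
  filter_upwards [hbhat, hlk.eventually_lt_const (lt_add_one _), hli.eventually_gt_atTop
    ((a c - a k) ^ 2 / (∑ j, v c j + ∑ j, v k j) + 1)] with l hb h1 h2 hs
  by_cases hgap : T.totalGap X l (T.jstar l) < 0
  · exact hic (hs.1.trans ((h.run.best l hgap).trans hb))
  · have h3 := (h.run.nonbest l hgap).2 k (hb.symm ▸ hkc)
    rw [← hs.1] at h3
    linarith

theorem eventually_bhat_eq (h : T.IsRegularRun f n₀ n m x X wc μ σ b) :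
    ∀ᶠ l in atTop, T.bhat l = b :=
  eventually_eq_of_isMax (h.tendsto_muHat (o := fun _ _ => none) h.tendsto_N) h.best
    (Eventually.of_forall h.run.bhat_max)

theorem eventually_sel_eq (h : T.IsRegularRun f n₀ n m x X wc μ σ b) :
    ∀ᶠ t in atTop, T.sel t = b := by
  refine eventually_eq_of_isMax (v := T.muStage n X) (a := perf μ wc) (fun i => ?_) h.best ?_
  · exact tendsto_finsetSum _ fun j _ => (tendsto_pi_nhds.1 h.weight_tendsto j).mul
      ((h.mean_tendsto i j).comp ((h.tendsto_N i j).comp h.budget))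
  · filter_upwards [eventually_ge_atTop 1] with t ht using h.run.sel_max t ht

/-! ### Input balance. -/

lemma tendsto_sdPair (h : T.IsRegularRun f n₀ n m x X wc μ σ b) (i : Fin K) (j : Fin D) :
    Tendsto (fun l => T.sdPair X l i j) atTop (𝓝 (σ i j)) :=
  (h.sd_tendsto i j).comp (h.tendsto_N i j)

lemma ratio_nonneg (l : ℕ) (i : Fin K) (j : Fin D) : 0 ≤ T.ratio l i j :=
  div_nonneg (Nat.cast_nonneg _) (Nat.cast_nonneg _)

lemma ratio_le_one (l : ℕ) (i : Fin K) (j : Fin D) : T.ratio l i j ≤ 1 :=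
  div_le_one_of_le₀ (Nat.cast_le.2 (N_le_total l i j)) (Nat.cast_nonneg _)

/-- The left side grows only when `j` is simulated, and then it is at most `1 + ε / 2` times the
quotient of `k` plus the increment `c` of one sample; half of `ε` pays for estimation error, and
divergence of the size of `k` absorbs `c`. -/
lemma eventually_div_le (h : T.IsRegularRun f n₀ n m x X wc μ σ b) (i : Fin K) (j k : Fin D)
    {ε : ℝ} (hε : 0 < ε) : ∀ᶠ l in atTop,
      (T.N l i j : ℝ) / (σ i j * wc j) ≤ (1 + ε) * ((T.N l i k : ℝ) / (σ i k * wc k)) := by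
  have hj := mul_pos (h.sigma_pos i j) (h.weight_pos j)
  have hk := mul_pos (h.sigma_pos i k) (h.weight_pos k)
  have hρ : Tendsto (fun l => (T.sdPair X l i j * T.wcur n l j / (σ i j * wc j))
      / (T.sdPair X l i k * T.wcur n l k / (σ i k * wc k))) atTop (𝓝 1) := by
    have h1 := (((h.tendsto_sdPair i j).mul (h.tendsto_wcur j)).div_const (σ i j * wc j)).div
      (((h.tendsto_sdPair i k).mul (h.tendsto_wcur k)).div_const (σ i k * wc k))
      (by rw [div_self hk.ne']; exact one_ne_zero)
    rwa [div_self hk.ne', div_self hj.ne', div_one] at h1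
  have hε2 : 0 < ε / 2 := half_pos hε
  let c : ℝ := 1 / (σ i j * wc j)
  have hmono : Monotone fun l => (T.N l i k : ℝ) / (σ i k * wc k) := fun p q hpq =>
    div_le_div_of_nonneg_right (Nat.cast_le.2 (h.monotone_N i k hpq)) hk.le
  have hB : Monotone fun l => (1 + ε / 2) * ((T.N l i k : ℝ) / (σ i k * wc k)) + c :=
    fun p q hpq => add_le_add_left (mul_le_mul_of_nonneg_left (hmono hpq) (by linarith)) c
  have hev : ∀ᶠ l in atTop, (T.N (l + 1) i j : ℝ) / (σ i j * wc j) ≤ (T.N l i j : ℝ) / (σ i j * wc j)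
      ∨ (T.N (l + 1) i j : ℝ) / (σ i j * wc j)
        ≤ (1 + ε / 2) * ((T.N (l + 1) i k : ℝ) / (σ i k * wc k)) + c := by
    filter_upwards [h.eventually_div_le_of_sampled i j k, h.eventually_wcur_pos,
      hρ.eventually_lt_const (show (1 : ℝ) < 1 + ε / 2 by linarith)] with l h1 h2 h3
    by_cases hs : i = T.I l ∧ j = T.J l
    · right
      have h4 := h1 hs
      have hpj := mul_pos (h.sdPair_pos l i j) (h2 j)
      have hpk := mul_pos (h.sdPair_pos l i k) (h2 k)
      rw [div_le_div_iff₀ hpj hpk] at h4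
      rw [div_lt_iff₀ (div_pos hpk hk)] at h3
      have hNk : (0 : ℝ) ≤ T.N l i k := Nat.cast_nonneg _
      have h5 : (T.N l i j : ℝ) / (σ i j * wc j)
          ≤ (1 + ε / 2) * ((T.N l i k : ℝ) / (σ i k * wc k)) := by
        refine le_of_mul_le_mul_right ?_ hpk
        calc (T.N l i j : ℝ) / (σ i j * wc j) * (T.sdPair X l i k * T.wcur n l k)
            = (T.N l i j : ℝ) * (T.sdPair X l i k * T.wcur n l k) / (σ i j * wc j) := by ring
          _ ≤ (T.N l i k : ℝ) * (T.sdPair X l i j * T.wcur n l j) / (σ i j * wc j) :=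
              div_le_div_of_nonneg_right h4 hj.le
          _ = (T.N l i k : ℝ) * (T.sdPair X l i j * T.wcur n l j / (σ i j * wc j)) := by ring
          _ ≤ (T.N l i k : ℝ) * ((1 + ε / 2) * (T.sdPair X l i k * T.wcur n l k / (σ i k * wc k))) :=
              mul_le_mul_of_nonneg_left h3.le hNk
          _ = _ := by ring
      have h6 : (T.N (l + 1) i j : ℝ) / (σ i j * wc j) ≤ (T.N l i j : ℝ) / (σ i j * wc j) + c := by
        rw [← add_div]
        refine div_le_div_of_nonneg_right ?_ hj.le
        exact_mod_cast h.N_succ_le l i j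
      have h7 := mul_le_mul_of_nonneg_left (hmono (Nat.le_succ l))
        (show (0 : ℝ) ≤ 1 + ε / 2 by linarith)
      simp only [Nat.succ_eq_add_one] at h7
      linarith
    · left
      rw [h.N_succ_of_ne hs]
  obtain ⟨l₀, hl₀⟩ := eventually_atTop.1 hev
  have hbar := le_max_of_barrier (a := fun l => (T.N l i j : ℝ) / (σ i j * wc j)) hB hl₀
  have htop := tendsto_div_atTop_of_none hk tendsto_const_nhds (h.tendsto_N i k)
  filter_upwards [eventually_ge_atTop l₀, htop.eventually_ge_atTop ((T.N l₀ i j : ℝ) / (σ i j * wc j)),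
    htop.eventually_ge_atTop (c / (ε / 2)), htop.eventually_ge_atTop 0] with l h1 h2 h3 h4
  refine (hbar l h1).trans (max_le ?_ ?_)
  · nlinarith
  · rw [div_le_iff₀ hε2] at h3
    show (1 + ε / 2) * ((T.N l i k : ℝ) / (σ i k * wc k)) + c ≤ _
    linarith

/-- Asymptotic input balance, for every design. -/
theorem tendsto_ratio_sub (h : T.IsRegularRun f n₀ n m x X wc μ σ b) (i : Fin K) (j k : Fin D) :
    Tendsto (fun l => T.ratio l i j / (σ i j * wc j) - T.ratio l i k / (σ i k * wc k))
      atTop (𝓝 0) := by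
  have hle : ∀ j k, ∀ δ > 0, ∀ᶠ l in atTop,
      T.ratio l i j / (σ i j * wc j) - T.ratio l i k / (σ i k * wc k) < δ := fun j k δ hδ => by
    have hk := mul_pos (h.sigma_pos i k) (h.weight_pos k)
    -- The factor `σ i k * wc k` cancels the normalisation, leaving an error of `ratio * (δ / 2)`.
    filter_upwards [h.eventually_div_le i j k (mul_pos hk (half_pos hδ))] with l hl
    have hT := h.total_pos l
    have h1 := div_le_div_of_nonneg_right hl hT.le
    have h2 : T.ratio l i j / (σ i j * wc j) ≤ (1 + σ i k * wc k * (δ / 2)) *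
        (T.ratio l i k / (σ i k * wc k)) := by
      have e : ∀ j, T.ratio l i j / (σ i j * wc j)
          = (T.N l i j : ℝ) / (σ i j * wc j) / (T.total l : ℝ) := fun j => div_right_comm _ _ _
      rw [e, e, ← mul_div_assoc]
      exact h1
    have h3 : σ i k * wc k * (δ / 2) * (T.ratio l i k / (σ i k * wc k)) = T.ratio l i k * (δ / 2) := by
      rw [mul_right_comm, mul_div_cancel₀ _ hk.ne']
    have h4 := ratio_le_one (T := T) l i k
    nlinarith
  rw [Metric.tendsto_nhds]
  intro δ hδ
  filter_upwards [hle j k δ hδ, hle k j δ hδ] with l h1 h2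
  rw [Real.dist_eq, sub_zero, abs_lt]
  constructor <;> linarith

/-! ### Total balance. -/

/-- Total balance gap of component `j`, with the true standard deviations and best design. -/
noncomputable def trueGap (T : Trajectory K D) (σ : Fin K → Fin D → ℝ) (b : Fin K) (l : ℕ)
    (j : Fin D) : ℝ :=
  ((T.N l b j : ℝ) / σ b j) ^ 2 - ∑ i ∈ Finset.univ.erase b, ((T.N l i j : ℝ) / σ i j) ^ 2

lemma trueGap_div_sq (l : ℕ) (j : Fin D) : trueGap T σ b l j / (T.total l : ℝ) ^ 2
    = (T.ratio l b j / σ b j) ^ 2 - ∑ i ∈ Finset.univ.erase b, (T.ratio l i j / σ i j) ^ 2 := by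
  unfold trueGap ratio
  rw [sub_div, Finset.sum_div]
  congr 1
  · ring
  · exact Finset.sum_congr rfl fun i _ => by ring

lemma tendsto_totalGap_sub (h : T.IsRegularRun f n₀ n m x X wc μ σ b) (j : Fin D) :
    Tendsto (fun l => T.totalGap X l j / (T.total l : ℝ) ^ 2
      - trueGap T σ b l j / (T.total l : ℝ) ^ 2) atTop (𝓝 0) := by
  have hterm : ∀ i, Tendsto (fun l => ((T.N l i j : ℝ) / T.sdPair X l i j) ^ 2 / (T.total l : ℝ) ^ 2
      - ((T.N l i j : ℝ) / σ i j) ^ 2 / (T.total l : ℝ) ^ 2) atTop (𝓝 0) := fun i => by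
    have h1 : Tendsto (fun l => (T.sdPair X l i j ^ 2)⁻¹ - (σ i j ^ 2)⁻¹) atTop (𝓝 0) := by
      have := (((h.tendsto_sdPair i j).pow 2).inv₀ (pow_pos (h.sigma_pos i j) 2).ne').sub_const
        (σ i j ^ 2)⁻¹
      rwa [sub_self] at this
    have h2 : IsBoundedUnder (· ≤ ·) atTop (fun l => ‖T.ratio l i j ^ 2‖) :=
      isBoundedUnder_of ⟨1, fun l => by
        rw [Real.norm_eq_abs, abs_of_nonneg (sq_nonneg _)]
        exact pow_le_one₀ (ratio_nonneg l i j) (ratio_le_one l i j)⟩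
    refine (h1.zero_mul_isBoundedUnder_le h2).congr fun l => ?_
    unfold ratio
    ring
  have hall := (hterm b).sub (tendsto_finsetSum (Finset.univ.erase b) fun i _ => hterm i)
  rw [Finset.sum_const_zero, sub_zero] at hall
  refine hall.congr' ?_
  filter_upwards [h.eventually_bhat_eq] with l hb
  unfold totalGap trueGap
  rw [hb, Finset.sum_sub_distrib, ← Finset.sum_div, ← Finset.sum_div]
  ring

/-- Difference of squares: input balance makes one factor vanish and the other is bounded. This lets
a large gap in one component determine the sign of the gaps in all the others. -/
lemma tendsto_trueGap_sub (h : T.IsRegularRun f n₀ n m x X wc μ σ b) (j k : Fin D) :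
    Tendsto (fun l => trueGap T σ b l j / (T.total l : ℝ) ^ 2 / wc j ^ 2
      - trueGap T σ b l k / (T.total l : ℝ) ^ 2 / wc k ^ 2) atTop (𝓝 0) := by
  have hterm : ∀ i, Tendsto (fun l => (T.ratio l i j / σ i j) ^ 2 / wc j ^ 2
      - (T.ratio l i k / σ i k) ^ 2 / wc k ^ 2) atTop (𝓝 0) := fun i => by
    have h2 : IsBoundedUnder (· ≤ ·) atTop
        (fun l => ‖T.ratio l i j / (σ i j * wc j) + T.ratio l i k / (σ i k * wc k)‖) :=
      isBoundedUnder_of ⟨1 / (σ i j * wc j) + 1 / (σ i k * wc k), fun l => by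
        have hj := mul_pos (h.sigma_pos i j) (h.weight_pos j)
        have hk := mul_pos (h.sigma_pos i k) (h.weight_pos k)
        have h3 := ratio_nonneg (T := T) l i j
        have h4 := ratio_nonneg (T := T) l i k
        rw [Real.norm_eq_abs, abs_of_nonneg (by positivity)]
        exact add_le_add (div_le_div_of_nonneg_right (ratio_le_one l i j) hj.le)
          (div_le_div_of_nonneg_right (ratio_le_one l i k) hk.le)⟩
    refine ((h.tendsto_ratio_sub i j k).zero_mul_isBoundedUnder_le h2).congr fun l => ?_
    ring
  have hall := (hterm b).sub (tendsto_finsetSum (Finset.univ.erase b) fun i _ => hterm i)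
  rw [Finset.sum_const_zero, sub_zero] at hall
  refine hall.congr fun l => ?_
  rw [trueGap_div_sq, trueGap_div_sq, Finset.sum_sub_distrib, ← Finset.sum_div, ← Finset.sum_div]
  ring

/-- A size grows by at most one, so its square grows by at most twice the new size. -/
lemma sq_div_succ_bounds (h : T.IsRegularRun f n₀ n m x X wc μ σ b) (l : ℕ) (i : Fin K)
    (j : Fin D) : ((T.N l i j : ℝ) / σ i j) ^ 2 ≤ ((T.N (l + 1) i j : ℝ) / σ i j) ^ 2 ∧
      ((T.N (l + 1) i j : ℝ) / σ i j) ^ 2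
        ≤ ((T.N l i j : ℝ) / σ i j) ^ 2 + 2 / σ i j ^ 2 * T.total (l + 1) := by
  have hσ := h.sigma_pos i j
  have h1 : (T.N l i j : ℝ) ≤ T.N (l + 1) i j := Nat.cast_le.2 (h.monotone_N i j (Nat.le_succ l))
  have h2 : (T.N (l + 1) i j : ℝ) ≤ T.N l i j + 1 := by exact_mod_cast h.N_succ_le l i j
  have h3 : (T.N (l + 1) i j : ℝ) ≤ T.total (l + 1) := Nat.cast_le.2 (N_le_total _ i j)
  have h0 : (0 : ℝ) ≤ T.N l i j := Nat.cast_nonneg _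
  have hσ2 : 0 < σ i j ^ 2 := by positivity
  simp only [div_pow]
  constructor
  · gcongr
  · have : (T.N l i j : ℝ) ^ 2 / σ i j ^ 2 + 2 / σ i j ^ 2 * T.total (l + 1)
        = ((T.N l i j : ℝ) ^ 2 + 2 * T.total (l + 1)) / σ i j ^ 2 := by ring
    rw [this]
    refine div_le_div_of_nonneg_right ?_ hσ2.le
    nlinarith

lemma eventually_abs_trueGap_le (h : T.IsRegularRun f n₀ n m x X wc μ σ b) (k : Fin D)
    {ε : ℝ} (hε : 0 < ε) : ∀ᶠ l in atTop, |trueGap T σ b l k| ≤ ε * (T.total l : ℝ) ^ 2 := by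
  have hS0 : ∀ l, (0 : ℝ) ≤ T.total l := fun l => Nat.cast_nonneg _
  have hup : ∀ᶠ l in atTop, trueGap T σ b l k ≤ ε * (T.total l : ℝ) ^ 2 := by
    refine eventually_le_mul_sq_of_drift (g := fun l => trueGap T σ b l k)
      (c := 2 / σ b k ^ 2) (by positivity) hS0 h.monotone_total h.tendsto_total
      (fun l => ?_) (fun δ hδ => ?_) hε
    · have h1 := (h.sq_div_succ_bounds l b k).2
      have h2 := Finset.sum_le_sum fun i (_ : i ∈ Finset.univ.erase b) =>
        (h.sq_div_succ_bounds l i k).1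
      unfold trueGap
      linarith
    -- A large gap in `k` makes all estimated gaps nonnegative, so `b` is not simulated and the gap
    -- cannot increase.
    · have hpos : ∀ j, ∀ᶠ l in atTop, δ * (T.total l : ℝ) ^ 2 < trueGap T σ b l k →
          0 ≤ T.totalGap X l j := fun j => by
        have h1 := ((h.tendsto_totalGap_sub j).div_const (wc j ^ 2)).add (h.tendsto_trueGap_sub j k)
        rw [zero_div, add_zero] at h1
        have hw := pow_pos (h.weight_pos k) 2
        have hwj := pow_pos (h.weight_pos j) 2
        filter_upwards [h1.eventually_const_lt (neg_neg_of_pos (div_pos hδ hw))] with l h2 h3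
        have hT := pow_pos (h.total_pos l) 2
        rw [← lt_div_iff₀ hT] at h3
        have h4 := div_lt_div_of_pos_right h3 hw
        have h5 : 0 < T.totalGap X l j / (T.total l : ℝ) ^ 2 / wc j ^ 2 := by
          rw [sub_div] at h2
          linarith
        by_contra hneg
        have : T.totalGap X l j / (T.total l : ℝ) ^ 2 / wc j ^ 2 ≤ 0 :=
          div_nonpos_of_nonpos_of_nonneg
            (div_nonpos_of_nonpos_of_nonneg (not_le.1 hneg).le hT.le) hwj.le
        linarith
      filter_upwards [h.eventually_bhat_eq, eventually_all.2 hpos] with l hb h1 h2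
      have hI := (h.run.nonbest l (not_lt.2 (h1 (T.jstar l) h2))).1
      have h3 : T.N (l + 1) b k = T.N l b k :=
        h.N_succ_of_ne fun hs => hI (hs.1.symm.trans hb.symm)
      have h4 := Finset.sum_le_sum fun i (_ : i ∈ Finset.univ.erase b) =>
        (h.sq_div_succ_bounds l i k).1
      unfold trueGap
      rw [h3]
      linarith
  have hlow : ∀ᶠ l in atTop, -trueGap T σ b l k ≤ ε * (T.total l : ℝ) ^ 2 := by
    refine eventually_le_mul_sq_of_drift (g := fun l => -trueGap T σ b l k)
      (c := ∑ i ∈ Finset.univ.erase b, 2 / σ i k ^ 2)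
      (Finset.sum_nonneg fun i _ => by positivity) hS0 h.monotone_total h.tendsto_total
      (fun l => ?_) (fun δ hδ => ?_) hε
    · have h1 := (h.sq_div_succ_bounds l b k).1
      have h2 := Finset.sum_le_sum fun i (_ : i ∈ Finset.univ.erase b) =>
        (h.sq_div_succ_bounds l i k).2
      rw [Finset.sum_add_distrib, ← Finset.sum_mul] at h2
      unfold trueGap
      linarith
    -- Here component `k` alone makes the minimum negative, so `b` is simulated and the gap cannot
    -- decrease.
    · filter_upwards [h.eventually_bhat_eq,
        (h.tendsto_totalGap_sub k).eventually_lt_const hδ] with l hb h1 h2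
      have hT := pow_pos (h.total_pos l) 2
      rw [← sub_div, div_lt_iff₀ hT] at h1
      have hgap : T.totalGap X l k < 0 := by linarith
      have hI := (h.run.best l ((h.run.jstar_min l k).trans_lt hgap)).trans hb
      have h3 : ∑ i ∈ Finset.univ.erase b, ((T.N (l + 1) i k : ℝ) / σ i k) ^ 2
          = ∑ i ∈ Finset.univ.erase b, ((T.N l i k : ℝ) / σ i k) ^ 2 :=
        Finset.sum_congr rfl fun i hi => by
          rw [h.N_succ_of_ne fun hs => Finset.ne_of_mem_erase hi (hs.1.trans hI)]
      have h4 := (h.sq_div_succ_bounds l b k).1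
      unfold trueGap
      rw [h3]
      linarith
  filter_upwards [hup, hlow] with l h1 h2 using abs_le.2 ⟨by linarith, h1⟩

/-- Asymptotic total balance. -/
theorem tendsto_total_balance (h : T.IsRegularRun f n₀ n m x X wc μ σ b) (j : Fin D) :
    Tendsto (fun l => (T.ratio l b j / σ b j) ^ 2
      - ∑ i ∈ Finset.univ.erase b, (T.ratio l i j / σ i j) ^ 2) atTop (𝓝 0) := by
  rw [Metric.tendsto_nhds]
  intro δ hδ
  filter_upwards [h.eventually_abs_trueGap_le j (half_pos hδ)] with l hl
  have hT := pow_pos (h.total_pos l) 2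
  rw [← trueGap_div_sq, Real.dist_eq, sub_zero, abs_div, abs_of_pos hT, div_lt_iff₀ hT]
  nlinarith

end IsRegularRun

end Trajectory

end IUOCBA

/-! ### Almost every run is regular. -/

theorem theorem3 {K D : ℕ} (hK : 2 ≤ K)
    {Ω : Type*} [MeasurableSpace Ω] (P : Measure Ω) [IsProbabilityMeasure P]
    {Z : Type*} [MeasurableSpace Z]
    -- known components, with densities with respect to a common dominating measure
    (F : Fin D → Measure Z) [∀ j, IsProbabilityMeasure (F j)]
    (ν : Measure Z) [SigmaFinite ν] (f : Fin D → Z → ℝ≥0) (hf : ∀ j, Measurable (f j))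
    (hF : ∀ j, F j = ν.withDensity (fun z => (f j z : ℝ≥0∞)))
    -- true weights and identifiability
    (wc : Fin D → ℝ) (hwc_pos : ∀ j, 0 < wc j) (hwc_sum : ∑ j, wc j = 1)
    (hident : ∀ w ∈ stdSimplex ℝ (Fin D), w ≠ wc →
      IUOCBA.hellinger (IUOCBA.mixture F w) (IUOCBA.mixture F wc) ≠ 0)
    -- i.i.d. input data
    (ξ : ℕ → Ω → Z) (hξ_meas : ∀ s, Measurable (ξ s))
    (hξ_law : ∀ s, P.map (ξ s) = IUOCBA.mixture F wc) (hξ_indep : iIndepFun ξ P)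
    -- independent Gaussian simulation outputs
    (μ σ : Fin K → Fin D → ℝ) (hσ : ∀ i j, 0 < σ i j)
    (X : Fin K → Fin D → ℕ → Ω → ℝ) (hX_meas : ∀ i j r, Measurable (X i j r))
    (hX_law : ∀ i j r, P.map (X i j r) = gaussianReal (μ i j) (σ i j ^ 2).toNNReal)
    (hX_indep : iIndepFun (fun p : Fin K × Fin D × ℕ => X p.1 p.2.1 p.2.2) P)
    -- the best design; no two designs have the same expected performance
    (b : Fin K) (hb : ∀ i, i ≠ b → IUOCBA.perf μ wc i < IUOCBA.perf μ wc b)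
    (hdist : Function.Injective (IUOCBA.perf μ wc))
    -- initial sample size, stage-wise simulation budgets and input batch sizes
    (n₀ : ℕ) (hn₀ : 2 ≤ n₀) (n m : ℕ → ℕ)
    (hn : Tendsto (IUOCBA.cumul n) atTop atTop) (hm : Tendsto (IUOCBA.cumul m) atTop atTop)
    -- an execution of IU-OCBA-balance on these data
    (T : Ω → IUOCBA.Trajectory K D)
    (hT : ∀ᵐ ω ∂P, (T ω).IsBalanceRun f n₀ n m (fun s => ξ s ω) (fun i j r => X i j r ω)) :
    -- consistency
    ((∀ᵐ ω ∂P, ∀ᶠ t in atTop, (T ω).sel t = b) ∧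
      (∀ᵐ ω ∂P, ∀ᶠ l in atTop, (T ω).bhat l = b)) ∧
    -- asymptotic input balance
    (∀ i, i ≠ b → ∀ j j', j < j' → ∀ᵐ ω ∂P,
      Tendsto (fun l => |(T ω).ratio l i j / (σ i j * wc j)
        - (T ω).ratio l i j' / (σ i j' * wc j')|) atTop (𝓝 0)) ∧
    -- asymptotic total balance
    (∀ j, ∀ᵐ ω ∂P,
      Tendsto (fun l => |((T ω).ratio l b j / σ b j) ^ 2
        - ∑ i ∈ Finset.univ.erase b, ((T ω).ratio l i j / σ i j) ^ 2|) atTop (𝓝 0)) := by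
  have hatom : ∀ i j r, NullSingletonClass (P.map (X i j r)) := fun i j r => by
    rw [hX_law]
    exact nullSingletonClass_gaussianReal (Real.toNNReal_pos.2 (pow_pos (hσ i j) 2)).ne'
  have hpair : ∀ i j, Pairwise (Function.onFun (fun f g => IndepFun f g P) (X i j)) :=
    fun i j r s hrs => hX_indep.indepFun (i := (i, j, r)) (j := (i, j, s))
      (by simpa using hrs)
  have hweight := IUOCBA.ae_tendsto_of_isMLE hf hF hwc_pos hwc_sum hident hξ_meas hξ_law hξ_indep
  have hsample : ∀ᵐ ω ∂P, ∀ i j,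
      Tendsto (IUOCBA.sampleMean fun r => X i j r ω) atTop (𝓝 (μ i j)) ∧
        Tendsto (IUOCBA.sampleSD fun r => X i j r ω) atTop (𝓝 (σ i j)) :=
    ae_all_iff.2 fun i => ae_all_iff.2 fun j =>
      IUOCBA.ae_tendsto_sample_of_gaussian (hX_meas i j) (hσ i j) (hX_law i j) (hpair i j)
  have hne : ∀ᵐ ω ∂P, ∀ i j, X i j 0 ω ≠ X i j 1 ω :=
    ae_all_iff.2 fun i => ae_all_iff.2 fun j => by
      have := hatom i j 1
      exact IUOCBA.ae_ne_of_indepFun (hX_meas i j 0) (hX_meas i j 1) (hpair i j zero_ne_one)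
  have htie : ∀ᵐ ω ∂P, ∀ o : Fin K → Fin D → Option ℕ, (∀ i j, ∀ k ∈ o i j, 1 ≤ k) →
      ∀ i k, i ≠ k → ∑ j, wc j * IUOCBA.limitMean (μ i j) (fun r => X i j r ω) (o i j)
        ≠ ∑ j, wc j * IUOCBA.limitMean (μ k j) (fun r => X k j r ω) (o k j) := by
    -- Countability of the set of patterns `o` allows the quantifier to be exchanged with "almost
    -- surely"; the pattern realised by the run may then depend on `ω`.
    rw [ae_all_iff]
    intro o
    by_cases ho : ∀ i j, ∀ k ∈ o i j, 1 ≤ k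
    · have h : ∀ i k, i ≠ k → _ := fun i k hik =>
        IUOCBA.ae_limit_perf_ne hX_meas hX_indep hatom hwc_pos hdist o ho hik
      have h' : ∀ᵐ ω ∂P, ∀ i k, i ≠ k → _ := ae_all_iff.2 fun i => ae_all_iff.2 fun k =>
        eventually_imp_distrib_left.2 (h i k)
      filter_upwards [h'] with ω hω _ using hω
    · exact ae_of_all _ fun ω h => absurd h ho
  have hreg : ∀ᵐ ω ∂P, (T ω).IsRegularRun f n₀ n m (fun s => ξ s ω) (fun i j r => X i j r ω)
      wc μ σ b := by
    filter_upwards [hT, hweight, hsample, hne, htie] with ω h1 h2 h3 h4 h5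
    exact
      { run := h1
        two_le_init := hn₀
        nonempty := by
          by_contra h
          rw [not_nonempty_iff] at h
          simp at hwc_sum
        budget := hn
        weight_pos := hwc_pos
        sigma_pos := hσ
        best := hb
        weight_tendsto := h2 _ _ hm ((eventually_ge_atTop 1).mono fun t ht => h1.weight t ht)
        mean_tendsto := fun i j => (h3 i j).1
        sd_tendsto := fun i j => (h3 i j).2
        sd_pos := fun i j N hN => IUOCBA.sampleSD_pos (h4 i j) hN
        limit_ne := h5 }
  refine ⟨⟨hreg.mono fun ω h => h.eventually_sel_eq, hreg.mono fun ω h => h.eventually_bhat_eq⟩,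
    fun i _ j j' _ => hreg.mono fun ω h => ?_, fun j => hreg.mono fun ω h => ?_⟩
  · simpa using (h.tendsto_ratio_sub i j j').abs
  · simpa using (h.tendsto_total_balance j).abs
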